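/- Let $(W,S)$ be a finite Coxeter system with Coxeter matrix $m$. Let $V=\mathbb{R}^S$ have basis $\{\alpha_s\}_{s\in S}$ and bilinear form $(\alpha_s,\alpha_t)=-\cos(\pi/m(s,t))$, let $W$ act by $s(v)=v-2(v,\alpha_s)\alpha_s$, let $\Phi=\{w(\alpha_s): w\in W, s\in S\}$, let $\Phi^+$ be the set of roots with nonnegative coordinates, and let $M=M_\Phi$ be the matroid of linear dependencies on the ground set $E=\Phi^+$ (the matroid of the Coxeter arrangement). For $\omega\in\mathbb{R}^E$ let $M_\omega$ be the matroid whose bases are the bases of $M$ of minimum $\omega$-weight. The Bergman complex $\mathcal{B}(M)$ is the set of all $\omega\in\mathbb{R}^E$ with $\sum_e\omega_e=0$ and $\sum_e\omega_e^2=1$ for which $M_\omega$ has no loops; its coarse cells are the classes of the relation $M_\omega=M_\nu$ on $\mathcal{B}(M)$. Let $L$ be the lattice of flats of $M$. An element $y\neq\hat 0$ of $L$ is irreducible if $[\hat 0,y]$ is not isomorphic to a product $[\hat 0,x_1]\times[\hat 0,x_2]$ with $x_1,x_2<y$; the maximal irreducible elements are the connected components of $M$. A set of irreducible elements is nested if the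 join of any of its antichains with at least two elements is not irreducible; it is reduced if it contains no connected component of $M$. The nested set complex $\mathcal{N}(M)$ is the simplicial complex of the nonempty reduced nested sets. For a reduced nested set $N$ (possibly empty), let $C_N$ be the set of all $\omega$ with $\sum_e\omega_e=0$ and $\sum_e\omega_e^2=1$ of the form $$\omega=-\sum_{G\in N}a_G\,\mathbf 1_G-\sum_{C}a_C\,\mathbf 1_C,\qquad a_G>0 \ (G\in N),\quad a_C\in\mathbb{R},$$ where $C$ runs over the connected components of $M$ and $\mathbf 1_X\in\mathbb{R}^E$ is the indicator vector of $X$. Then the coarse subdivision of $\mathcal{B}(M_\Phi)$ is equal to the nested set complex, in the following sense. 1. The coarse cells of $\mathcal{B}(M)$ are exactly the nonempty sets among the $C_N$, $N$ a reduced nested set. 2. For reduced nested sets $N,N'$ with $C_N\neq\emptyset$, one has $C_N\subseteq\overline{C_{N'}}$ if and only if $N\subseteq N'$. 3. Let $U=\{\omega:\sum_{e\in C}\omega_e=0 \text{ for every connected component } C \text{ of } M\}$. There is a homeomorphism from the geometric realization of $\mathcal{N}(M)$ onto $\mathcal{B}(M)\cap U$ that maps the open simplex of each $N\in\mathcal{N}(M)$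 onto $C_N\cap U$. 4. In particular, if $(W,S)$ is irreducible, then $\mathcal{B}(M)$ with its coarse subdivision is a simplicial complex: there is a homeomorphism from the geometric realization of $\mathcal{N}(M)$ onto $\mathcal{B}(M)$ that maps the open simplex of each $N\in\mathcal{N}(M)$ onto the coarse cell $C_N$. -/

import Mathlib

open Set

noncomputable section

namespace CoxeterBergman

/-! ### Irreducible elements and nested sets of a finite lattice -/

section Nested

variable {L : Type*} [PartialOrder L]

/-- `y` is irreducible: it is not the bottom element (whose interval is the empty product), and
`[0, y]` is not a product of two smaller intervals `[0, x₁] × [0, x₂]`. -/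
def IsIrred (y : L) : Prop :=
  ¬ IsBot y ∧ ∀ x₁ x₂ : L, x₁ < y → x₂ < y → IsEmpty ((Iic x₁ × Iic x₂) ≃o Iic y)

/-- A set of irreducible elements is nested if the join of each of its antichains with at least
two elements is not irreducible. -/
def IsNested (X : Finset L) : Prop :=
  (∀ x ∈ X, IsIrred x) ∧
    ∀ A : Finset L, A ⊆ X → 2 ≤ A.card → IsAntichain (· ≤ ·) (A : Set L) →
      ∃ y, IsLUB (A : Set L) y ∧ ¬ IsIrred y

/-- A nested set none of whose elements is a maximal irreducible element.  In the lattice of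
flats the maximal irreducible elements are the connected components; they can be added to every
nested set, that is, they are cone points of the complex of all nested sets. -/
def IsReducedNested (X : Finset L) : Prop :=
  IsNested X ∧ ∀ x ∈ X, ¬ Maximal IsIrred x

lemma IsNested.mono {X Y : Finset L} (h : IsNested X) (hY : Y ⊆ X) : IsNested Y :=
  ⟨fun x hx ↦ h.1 x (hY hx), fun A hA ↦ h.2 A (hA.trans hY)⟩

lemma IsReducedNested.mono {X Y : Finset L} (h : IsReducedNested X) (hY : Y ⊆ X) :
    IsReducedNested Y :=
  ⟨h.1.mono hY, fun x hx ↦ h.2 x (hY hx)⟩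

variable (L) in
/-- The (reduced, minimal) nested set complex: its simplices are the nonempty nested sets without
maximal irreducible elements. -/
def nestedSetComplex : PreAbstractSimplicialComplex L where
  faces := {X | X.Nonempty ∧ IsReducedNested X}
  isRelLowerSet_faces := fun _ hX ↦ ⟨hX.1, fun _ hY hne ↦ ⟨hne, hX.2.mono hY⟩⟩

end Nested

/-! ### Geometric realization of a finite simplicial complex -/

section Realization

variable {ι : Type*} [Fintype ι]

/-- The open simplex on the vertex set `X`, in barycentric coordinates. -/
def openSimplex (X : Finset ι) : Set (ι → ℝ) :=
  {t | (∀ i ∈ X, 0 < t i) ∧ (∀ i ∉ X, t i = 0) ∧ ∑ i, t i = 1}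

/-- The standard geometric realization `|K|`: the union of the open simplices of the faces. -/
def realization (K : PreAbstractSimplicialComplex ι) : Set (ι → ℝ) :=
  ⋃ X ∈ K.faces, openSimplex X

/-- The space `Z`, with the cells `cell X` indexed by the faces `X` of `K`, is a simplicial complex
with face complex `K`: there is a homeomorphism `|K| ≃ Z` which maps the open simplex of each
face `X` onto `cell X`. -/
def IsRealizationOf {β : Type*} [TopologicalSpace β] (K : PreAbstractSimplicialComplex ι)
    (Z : Set β) (cell : Finset ι → Set β) : Prop :=
  ∃ h : realization K ≃ₜ Z, ∀ X ∈ K.faces,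
    (fun t ↦ (h t : β)) '' {t : realization K | (t : ι → ℝ) ∈ openSimplex X} = cell X

end Realization

/-! ### Bergman complexes of matroids -/

section Bergman

variable {α : Type*}

/-- The lattice of flats, ordered by inclusion. -/
abbrev Flats (M : Matroid α) : Type _ := {F : Set α // M.IsFlat F}

instance [Finite α] (M : Matroid α) : Fintype (Flats M) := Fintype.ofFinite _

/-- Symmetric exchange of bases. -/
lemma exists_symm_exchange (M : Matroid α) {X Y : Set α} (hX : M.IsBase X) (hY : M.IsBase Y)
    {e : α} (he : e ∈ X \ Y) :
    ∃ f ∈ Y \ X, M.IsBase (insert f (X \ {e})) ∧ M.IsBase (insert e (Y \ {f})) := by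
  have heE : e ∈ M.E := hX.subset_ground he.1
  have hcirc := hY.fundCircuit_isCircuit heE he.2
  have hcl := hcirc.mem_closure_sdiff_singleton_of_mem (M.mem_fundCircuit e Y)
  have hns : ¬ (M.fundCircuit e Y \ {e} ⊆ M.closure (X \ {e})) := fun hss ↦
    hX.indep.notMem_closure_sdiff_of_mem he.1 (M.closure_subset_closure_of_subset_closure hss hcl)
  obtain ⟨f, ⟨hfC, hfe⟩, hf⟩ := not_subset.1 hns
  have hfe' : f ≠ e := hfe
  have hfY : f ∈ Y := (M.fundCircuit_subset_insert e Y hfC).resolve_left hfe'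
  have hfE : f ∈ M.E := hY.subset_ground hfY
  have hfX : f ∉ X := fun hfX ↦ hf (M.mem_closure_of_mem' ⟨hfX, hfe⟩ hfE)
  refine ⟨f, ⟨hfY, hfX⟩, hX.exchange_base_of_notMem_closure he.1 hf, ?_⟩
  apply hY.exchange_isBase_of_indep he.2
  rw [hY.indep.mem_fundCircuit_iff (by rwa [hY.closure_eq]) he.2] at hfC
  rwa [insert_sdiff_of_notMem _ (by simpa using hfe'.symm)] at hfC

variable [Fintype α]

/-- The `ω`-weight of a set of elements. -/
def weight (ω : α → ℝ) (X : Set α) : ℝ := ∑ e, X.indicator ω e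

/-- `X` is a basis of `M` of minimum `ω`-weight. -/
def IsMinBase (M : Matroid α) (ω : α → ℝ) (X : Set α) : Prop :=
  M.IsBase X ∧ ∀ Y, M.IsBase Y → weight ω X ≤ weight ω Y

lemma weight_exchange (ω : α → ℝ) {X : Set α} {e f : α} (he : e ∈ X) (hf : f ∉ X) :
    weight ω (insert f (X \ {e})) = weight ω X - ω e + ω f := by
  classical
  have h : ∀ x, (insert f (X \ {e})).indicator ω x =
      X.indicator ω x - (if x = e then ω x else 0) + (if x = f then ω x else 0) := by
    intro x
    have hef : e ≠ f := fun h ↦ hf (h ▸ he)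
    by_cases h1 : x = e
    · subst h1; simp [indicator, he, hef]
    · by_cases h2 : x = f
      · subst h2; simp [indicator, hf, h1]
      · simp [indicator, h1, h2]
  simp only [weight, h, Finset.sum_add_distrib, Finset.sum_sub_distrib]
  simp

lemma isMinBase_exchange (M : Matroid α) (ω : α → ℝ) :
    Matroid.ExchangeProperty (IsMinBase M ω) := by
  intro X Y hX hY e he
  obtain ⟨f, hf, h1, h2⟩ := exists_symm_exchange M hX.1 hY.1 he
  refine ⟨f, hf, h1, fun Z hZ ↦ ?_⟩
  have w1 := weight_exchange ω he.1 hf.2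
  have w2 := weight_exchange ω hf.1 he.2
  have := hY.2 _ h2
  have := hX.2 _ hZ
  linarith

lemma exists_isMinBase (M : Matroid α) (ω : α → ℝ) : ∃ X, IsMinBase M ω X := by
  obtain ⟨X, hX, h⟩ := (Set.toFinite {X | M.IsBase X}).exists_minimalFor (weight ω) _
    M.exists_isBase
  refine ⟨X, hX, fun Y hY ↦ ?_⟩
  rcases le_total (weight ω X) (weight ω Y) with h' | h'
  · exact h'
  · exact h hY h'

/-- The matroid `M_ω` whose bases are the bases of `M` of minimum `ω`-weight. -/
def initialMatroid (M : Matroid α) (ω : α → ℝ) : Matroid α :=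
  Matroid.ofIsBaseOfFinite (E := M.E) (Set.toFinite _) (IsMinBase M ω) (exists_isMinBase M ω)
    (isMinBase_exchange M ω) (fun _ h ↦ h.1.subset_ground)

variable (α) in
/-- The sphere of weight vectors with sum of coordinates `0` and sum of squares `1`. -/
def weightSphere : Set (α → ℝ) := {ω | ∑ e, ω e = 0 ∧ ∑ e, ω e ^ 2 = 1}

/-- The Bergman complex of a matroid whose ground set is all of `α`. -/
def bergmanComplex (M : Matroid α) : Set (α → ℝ) :=
  {ω ∈ weightSphere α | (initialMatroid M ω).Loopless}

/-- The coarse subdivision: the classes of `ω ~ ν ↔ M_ω = M_ν` on the Bergman complex. -/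
def coarseCells (M : Matroid α) : Set (Set (α → ℝ)) :=
  (fun ω ↦ {ν ∈ bergmanComplex M | initialMatroid M ν = initialMatroid M ω}) '' bergmanComplex M

/-- The cell of a reduced nested set `N` of flats: the unit vectors of the form
`-∑_{G ∈ N} a_G 1_G - ∑_C a_C 1_C` with `a_G > 0` for `G ∈ N`, where `C` runs over the maximal
irreducible flats (the connected components) and the coefficients `a_C` are arbitrary. -/
def nestedCell (M : Matroid α) (N : Finset (Flats M)) : Set (α → ℝ) :=
  {ω ∈ weightSphere α | ∃ a : Flats M → ℝ, (∀ G ∈ N, 0 < a G) ∧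
    (∀ G ∉ N, ¬ Maximal IsIrred G → a G = 0) ∧
    ∀ e, ω e = -∑ G : Flats M, (G : Set α).indicator (fun _ ↦ a G) e}

/-- Weight vectors whose coordinates sum to `0` over each connected component (maximal irreducible
flat) of the matroid. -/
def componentSumZero (M : Matroid α) : Set (α → ℝ) :=
  {ω | ∀ C : Flats M, Maximal IsIrred C → weight ω (C : Set α) = 0}

end Bergman

/-! ### Coxeter systems, root systems and their matroids -/

section Coxeter

variable {B W : Type*} [Group W] [Fintype B] [DecidableEq B]

/-- The symmetric bilinear form `(α_s, α_t) = -cos (π / m(s,t))` on `ℝ^S`.  The value `m = 0`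
encodes `m = ∞`, where the formula gives `-1` as it should. -/
def coxeterForm (M : CoxeterMatrix B) : LinearMap.BilinForm ℝ (B → ℝ) :=
  Matrix.toBilin' (Matrix.of fun s t ↦ -Real.cos (Real.pi / (M s t : ℝ)))

/-- The simple root `α_s`, a standard basis vector. -/
def simpleRoot (s : B) : B → ℝ := Pi.single s 1

lemma coxeterForm_simpleRoot (M : CoxeterMatrix B) (s t : B) :
    coxeterForm M (simpleRoot s) (simpleRoot t) = -Real.cos (Real.pi / (M s t : ℝ)) := by
  simp [coxeterForm, simpleRoot, Matrix.toBilin'_single]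

/-- The linear functional `v ↦ 2 (v, α_s)`. -/
def coroot (M : CoxeterMatrix B) (s : B) : Module.Dual ℝ (B → ℝ) :=
  (2 : ℝ) • (coxeterForm M).flip (simpleRoot s)

lemma coroot_simpleRoot (M : CoxeterMatrix B) (s t : B) :
    coroot M s (simpleRoot t) = -2 * Real.cos (Real.pi / (M t s : ℝ)) := by
  simp [coroot, coxeterForm_simpleRoot]

lemma coroot_self (M : CoxeterMatrix B) (s : B) : coroot M s (simpleRoot s) = 2 := by
  simp [coroot_simpleRoot]

/-- The reflection `v ↦ v - 2 (v, α_s) α_s`. -/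
def simpleReflection (M : CoxeterMatrix B) (s : B) : (B → ℝ) ≃ₗ[ℝ] (B → ℝ) :=
  Module.reflection (coroot_self M s)

lemma simpleReflection_apply (M : CoxeterMatrix B) (s : B) (v : B → ℝ) :
    simpleReflection M s v = v - (2 * coxeterForm M v (simpleRoot s)) • simpleRoot s := by
  simp [simpleReflection, Module.reflection_apply, coroot]

/-- The reflections satisfy the Coxeter relations. -/
lemma isLiftable_simpleReflection (M : CoxeterMatrix B) :
    M.IsLiftable (simpleReflection M) := by
  intro s t
  by_cases hst : s = t
  · subst hst
    rw [M.diagonal, pow_one]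
    ext v : 1
    exact Module.involutive_reflection (coroot_self M s) v
  obtain hm | hm | hm : M s t = 0 ∨ M s t = 2 ∨ 3 ≤ M s t := by
    have := M.off_diagonal s t hst
    omega
  · rw [hm, pow_zero]
  · have h1 : coroot M s (simpleRoot t) = 0 := by
      rw [coroot_simpleRoot, M.symmetric t s, hm]; simp
    have h2 : coroot M t (simpleRoot s) = 0 := by
      rw [coroot_simpleRoot, hm]; simp
    have hs := coroot_self M s
    have ht := coroot_self M t
    rw [hm]
    apply LinearEquiv.ext
    intro v
    simp only [pow_two, LinearEquiv.mul_apply, simpleReflection, Module.reflection_apply, map_sub,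
      map_smul, h1, h2, hs, ht, LinearEquiv.coe_one, id_eq]
    module
  · have hm0 : (M s t : ℝ) ≠ 0 := by positivity
    have hm3 : (3 : ℝ) ≤ (M s t : ℝ) := by exact_mod_cast hm
    set θ : ℝ := 2 * (Real.pi / (M s t : ℝ)) with hθ
    have hmθ : (M s t : ℝ) * θ = 2 * Real.pi := by rw [hθ]; field_simp
    have hsin : Real.sin θ ≠ 0 := by
      apply ne_of_gt
      apply Real.sin_pos_of_pos_of_lt_pi
      · rw [hθ]; positivity
      · rw [hθ, ← mul_div_assoc, div_lt_iff₀ (by linarith)]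
        nlinarith [Real.pi_pos]
    have htt : 2 * Real.cos θ = coroot M s (simpleRoot t) * coroot M t (simpleRoot s) - 2 := by
      rw [coroot_simpleRoot, coroot_simpleRoot, M.symmetric t s, hθ, Real.cos_two_mul]
      ring
    have hS : ∀ n : ℤ, ((Polynomial.Chebyshev.S ℝ n).eval (2 * Real.cos θ)) =
        Real.sin ((n + 1) * θ) / Real.sin θ := by
      intro n
      rw [eq_div_iff hsin, Polynomial.Chebyshev.S_two_mul_real_cos]
    apply LinearEquiv.ext
    intro v
    rw [simpleReflection, simpleReflection,
      Module.reflection_mul_reflection_pow_apply _ _ _ _ _ htt]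
    obtain ⟨k, hk | hk⟩ := Nat.even_or_odd' (M s t)
    · have e1 : ((M s t : ℤ) - 2) / 2 = (k : ℤ) - 1 := by omega
      have e2 : ((M s t : ℤ) - 1) / 2 = (k : ℤ) - 1 := by omega
      have hkθ : (k : ℝ) * θ = Real.pi := by
        have : (M s t : ℝ) = 2 * k := by exact_mod_cast hk
        rw [this] at hmθ; linarith
      have z : ((Polynomial.Chebyshev.S ℝ ((k : ℤ) - 1)).eval (2 * Real.cos θ)) = 0 := by
        rw [hS]; push_cast; rw [sub_add_cancel, hkθ]; simp
      rw [e1, e2, z]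
      simp
    · have e1 : ((M s t : ℤ) - 2) / 2 = (k : ℤ) - 1 := by omega
      have e2 : ((M s t : ℤ) - 1) / 2 = (k : ℤ) := by omega
      have e3 : ((M s t : ℤ) - 3) / 2 = (k : ℤ) - 1 := by omega
      have e4 : (M s t : ℤ) / 2 = (k : ℤ) := by omega
      have hkθ : ((k : ℝ) + 1) * θ = 2 * Real.pi - k * θ := by
        have : (M s t : ℝ) = 2 * k + 1 := by exact_mod_cast hk
        rw [this] at hmθ; linarith
      have z : ((Polynomial.Chebyshev.S ℝ (k : ℤ)).eval (2 * Real.cos θ)) +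
          ((Polynomial.Chebyshev.S ℝ ((k : ℤ) - 1)).eval (2 * Real.cos θ)) = 0 := by
        rw [hS, hS]; push_cast
        rw [sub_add_cancel, hkθ, Real.sin_two_pi_sub]; ring
      rw [e1, e2, e3, e4, z]
      simp

variable {M : CoxeterMatrix B} (cs : CoxeterSystem M W)

/-- The geometric representation of `W` on `ℝ^S`. -/
def geometricRep : W →* ((B → ℝ) ≃ₗ[ℝ] (B → ℝ)) :=
  cs.lift ⟨simpleReflection M, isLiftable_simpleReflection M⟩

/-- The root system `Φ = {w(α_s)}`. -/
def rootSystem : Set (B → ℝ) :=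
  range fun p : W × B ↦ geometricRep cs p.1 (simpleRoot p.2)

/-- The positive roots: those with nonnegative coordinates in the basis of simple roots. -/
def positiveRoots : Set (B → ℝ) := {v ∈ rootSystem cs | ∀ s, 0 ≤ v s}

lemma finite_positiveRoots [Finite W] : (positiveRoots cs).Finite :=
  (Set.finite_range _).subset fun _ h ↦ h.1

instance [Finite W] : Fintype (positiveRoots cs) := (finite_positiveRoots cs).fintype

/-- The matroid `M_Φ` of linear dependencies of the positive roots; equivalently, the matroid of
the arrangement of their orthogonal hyperplanes in the dual space. -/
def rootMatroid : Matroid (positiveRoots cs) :=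
  (IndepMatroid.ofFinitaryCardAugment univ
    (fun I ↦ LinearIndepOn ℝ (Subtype.val : positiveRoots cs → (B → ℝ)) I)
    (linearIndepOn_empty _ _)
    (fun _ _ h hss ↦ h.mono hss)
    (by
      intro I J hI hIfin hJ hJfin hcard
      by_contra! hcon
      have hspan : ∀ e ∈ J, (e : B → ℝ) ∈ Submodule.span ℝ (Subtype.val '' I) := by
        intro e he
        by_cases heI : e ∈ I
        · exact Submodule.subset_span ⟨e, heI, rfl⟩
        · by_contra hnot
          exact hcon e he heI (hI.insert hnot)
      have hle : Submodule.span ℝ (Subtype.val '' J : Set (B → ℝ)) ≤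
          Submodule.span ℝ (Subtype.val '' I) :=
        Submodule.span_le.2 (by rintro _ ⟨e, he, rfl⟩; exact hspan e he)
      have h1 := Submodule.finrank_mono hle
      have := hIfin.to_subtype
      have := hJfin.to_subtype
      have := Fintype.ofFinite I
      have := Fintype.ofFinite J
      have hI' := finrank_span_eq_card hI.linearIndependent
      have hJ' := finrank_span_eq_card hJ.linearIndependent
      rw [← Set.image_eq_range, ← Nat.card_eq_fintype_card, Nat.card_coe_set_eq] at hI' hJ'
      omega)
    (fun I h ↦ linearIndepOn_of_finite I fun J hJ hfin ↦ h J hJ hfin)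
    (fun I _ ↦ subset_univ I)).matroid

/-- The Coxeter diagram: `s` and `t` are joined when `m(s,t) ≥ 3`, including `m(s,t) = ∞`. -/
def coxeterDiagram (M : CoxeterMatrix B) : SimpleGraph B where
  Adj s t := s ≠ t ∧ M s t ≠ 2
  symm := ⟨fun s t h ↦ ⟨h.1.symm, by rw [M.symmetric t s]; exact h.2⟩⟩
  loopless := ⟨fun _ h ↦ h.1 rfl⟩

end Coxeter

end CoxeterBergman

end

open CoxeterBergman

/-!
Let `M` be loopless, `N` a reduced nested set and `ω = -∑ a_G 1_G`, where `G` runs over `N` and the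
connected components and `a_G > 0` for `G ∈ N`.  A basis has minimum `ω`-weight iff it meets every
`G ∈ N` in a basis of `G`.  Nestedness provides such a basis through every element, so `M_ω` is
loopless and depends only on `N`.  Conversely, if `M_ω` is loopless, then the sublevel sets of `ω`
are flats whose connected components form a nested set, which writes `ω` in this form, uniquely.

Suppose moreover that `(M|G)/F` is connected for all flats `F < G` with `G` connected.  Exchanging
elements between minimum bases then shows that every `ν` with `M_ν = M_ω` is constant on the strata
`G \ ⋃_{H ∈ N, H < G} H`, hence lies in the same cone.  So the cones form a simplicial fan modulo
the span of the indicators of the components, and the link of this fan is the nested set complex.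

For the positive roots of a finite Coxeter group, suppose that `G \ F` splits into parts `T`, `T'`
skew in `M/F`.  Reflecting roots of `T` in roots of `T'` shows `T ⟂ T'`, and reflecting them in
roots of `F` shows that the roots of `G` orthogonal to `T` are orthogonal to the other roots of `G`.
The invariant form is positive definite because `W` is finite, so orthogonal sets are skew and `G`
is disconnected.
-/

noncomputable section

open scoped Matroid

namespace CoxeterBergman

section Connectivity

variable {α : Type*} {M : Matroid α} {A A' C C' F K X Y Z X' Y' : Set α} {e : α}

lemma closure_subset_of_isFlat (hF : M.IsFlat F) (hX : X ⊆ F) : M.closure X ⊆ F :=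
  (M.closure_subset_closure hX).trans_eq hF.closure

/-- The disjoint sets `X` and `Y` are skew: the restriction of `M` to `X ∪ Y` is the direct sum of
the restrictions to `X` and to `Y`. -/
structure Skew (M : Matroid α) (X Y : Set α) : Prop where
  disjoint : Disjoint X Y
  indep_union : ∀ ⦃I J⦄, I ⊆ X → J ⊆ Y → M.Indep I → M.Indep J → M.Indep (I ∪ J)

lemma Skew.symm (h : Skew M X Y) : Skew M Y X :=
  ⟨h.disjoint.symm, fun I J hI hJ hI' hJ' ↦ union_comm J I ▸ h.indep_union hJ hI hJ' hI'⟩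

lemma Skew.mono (h : Skew M X Y) (hX : X' ⊆ X) (hY : Y' ⊆ Y) : Skew M X' Y' :=
  ⟨h.disjoint.mono hX hY, fun _ _ hI hJ ↦ h.indep_union (hI.trans hX) (hJ.trans hY)⟩

lemma skew_empty_right (M : Matroid α) (X : Set α) : Skew M X ∅ where
  disjoint := disjoint_empty X
  indep_union I J _ hJ hI _ := by rwa [subset_empty_iff.1 hJ, union_empty]

lemma Skew.union_right (hXY : Skew M X Y) (h : Skew M (X ∪ Y) Z) : Skew M X (Y ∪ Z) where
  disjoint := hXY.disjoint.union_right (h.disjoint.mono_left subset_union_left)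
  indep_union I J hI hJ hI' hJ' := by
    have hIJ : M.Indep (I ∪ J ∩ Y) :=
      hXY.indep_union hI inter_subset_right hI' (hJ'.subset inter_subset_left)
    have := h.indep_union (union_subset_union hI inter_subset_right) inter_subset_right hIJ
      (hJ'.subset (inter_subset_left (t := Z)))
    rwa [union_assoc, ← inter_union_distrib_left, inter_eq_left.2 hJ] at this

lemma Skew.mem_closure_left (h : Skew M X Y) (he : e ∈ X) (hA : A ⊆ X) (hA' : A' ⊆ Y)
    (hcl : e ∈ M.closure (A ∪ A')) : e ∈ M.closure A := by
  by_contra hcon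
  obtain ⟨I, hI⟩ := M.exists_isBasis' A
  obtain ⟨J, hJ⟩ := M.exists_isBasis' A'
  have heI : M.Indep (insert e I) :=
    hI.indep.insert_indep_iff.2
      (.inl ⟨M.closure_subset_ground _ hcl, hI.closure_eq_closure ▸ hcon⟩)
  have hIJ : M.Indep (insert e (I ∪ J)) := insert_union ▸ h.indep_union
    (insert_subset he (hI.subset.trans hA)) (hJ.subset.trans hA') heI hJ.indep
  have heIJ : e ∉ I ∪ J := by
    rintro (heI | heJ)
    · exact hcon (hI.closure_eq_closure ▸ M.mem_closure_of_mem' heI (M.closure_subset_ground _ hcl))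
    · exact h.disjoint.notMem_of_mem_left he (hA' (hJ.subset heJ))
  rw [← M.closure_union_closure_left_eq, ← M.closure_union_closure_right_eq,
    ← hI.closure_eq_closure, ← hJ.closure_eq_closure, M.closure_union_closure_right_eq,
    M.closure_union_closure_left_eq] at hcl
  exact ((hIJ.subset (subset_insert e _)).insert_indep_iff_of_notMem heIJ).1 hIJ |>.2 hcl

lemma Skew.disjoint_closure [M.Loopless] (h : Skew M X Y) (hA : A ⊆ X) :
    Disjoint (M.closure A) Y := by
  refine disjoint_left.2 fun e he heY ↦ ?_
  have hloop : e ∈ M.closure ∅ :=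
    h.symm.mem_closure_left heY (empty_subset Y) hA (by rwa [empty_union])
  rwa [← Matroid.loops, M.loops_eq_empty] at hloop

/-- `K` is connected: it is nonempty and the restriction of `M` to `K` is not the direct sum of its
restrictions to two nonempty parts of `K`. -/
structure IsConnectedSet (M : Matroid α) (K : Set α) : Prop where
  nonempty : K.Nonempty
  eq_empty_or_eq_empty : ∀ ⦃Y Z⦄, Y ∪ Z = K → Skew M Y Z → Y = ∅ ∨ Z = ∅

lemma isConnectedSet_singleton (M : Matroid α) (e : α) : IsConnectedSet M {e} where
  nonempty := singleton_nonempty e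
  eq_empty_or_eq_empty Y Z hYZ h := by
    by_contra! hne
    have hY := (hne.1.subset_singleton_iff).1 (hYZ ▸ subset_union_left)
    have hZ := (hne.2.subset_singleton_iff).1 (hYZ ▸ subset_union_right)
    simpa [hY, hZ] using h.disjoint

lemma IsConnectedSet.subset_or_subset (hK : IsConnectedSet M K) (h : Skew M Y Z)
    (hKYZ : K ⊆ Y ∪ Z) : K ⊆ Y ∨ K ⊆ Z := by
  have hK' : K ∩ Y ∪ K ∩ Z = K := by rw [← inter_union_distrib_left, inter_eq_left.2 hKYZ]
  rcases hK.eq_empty_or_eq_empty hK' (h.mono inter_subset_right inter_subset_right) with h | h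
  · rw [h, empty_union, inter_eq_left] at hK'
    exact .inr hK'
  · rw [h, union_empty, inter_eq_left] at hK'
    exact .inl hK'

lemma IsConnectedSet.closure [M.Loopless] (hK : IsConnectedSet M K) (hKE : K ⊆ M.E) :
    IsConnectedSet M (M.closure K) where
  nonempty := hK.nonempty.mono (M.subset_closure K)
  eq_empty_or_eq_empty Y Z hYZ h := by
    rcases hK.subset_or_subset h (hYZ ▸ M.subset_closure K) with hKY | hKZ
    · exact .inr ((h.disjoint_closure hKY).eq_bot_of_ge (hYZ ▸ subset_union_right))
    · exact .inl ((h.symm.disjoint_closure hKZ).eq_bot_of_ge (hYZ ▸ subset_union_left))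

/-- `C` is a connected component of the restriction of `M` to `F`. -/
def IsComponent (M : Matroid α) (F C : Set α) : Prop :=
  Maximal (fun K ↦ IsConnectedSet M K ∧ K ⊆ F) C

lemma IsComponent.isConnectedSet (hC : IsComponent M F C) : IsConnectedSet M C := hC.prop.1

lemma IsComponent.subset (hC : IsComponent M F C) : C ⊆ F := hC.prop.2

lemma exists_isComponent_mem [Finite α] (M : Matroid α) (he : e ∈ F) :
    ∃ C, IsComponent M F C ∧ e ∈ C := by
  obtain ⟨C, heC, hC⟩ := (toFinite {K | IsConnectedSet M K ∧ K ⊆ F}).exists_le_maximal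
    ⟨isConnectedSet_singleton M e, singleton_subset_iff.2 he⟩
  exact ⟨C, hC, singleton_subset_iff.1 heC⟩

/-- A smallest skew summand of `F` containing `C` is connected. -/
lemma IsComponent.skew_sdiff [Finite α] (hC : IsComponent M F C) : Skew M C (F \ C) := by
  obtain ⟨Y, -, hY⟩ := (toFinite {Y | C ⊆ Y ∧ Y ⊆ F ∧ Skew M Y (F \ Y)}).exists_le_minimal
    (a := F) ⟨hC.subset, subset_rfl, by simpa using skew_empty_right M F⟩
  obtain ⟨hCY, hYF, hskew⟩ := hY.prop
  have hsummand : ∀ ⦃A B⦄, A ∪ B = Y → Skew M A B → C ⊆ A → B = ∅ := by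
    intro A B hAB h hCA
    have hFA : F \ A = B ∪ F \ Y := by
      subst hAB
      ext x
      have hF : x ∈ A ∪ B → x ∈ F := @hYF x
      have hB : x ∈ B → x ∉ A := fun h' ↦ disjoint_right.1 h.disjoint h'
      simp only [mem_sdiff, mem_union] at hF ⊢
      tauto
    have hYA : Y ⊆ A := hY.le_of_le
      ⟨hCA, (hAB ▸ subset_union_left).trans hYF, hFA ▸ h.union_right (hAB ▸ hskew)⟩
      (hAB ▸ subset_union_left)
    exact h.disjoint.symm.eq_bot_of_le ((hAB ▸ subset_union_right).trans hYA)
  have hYconn : IsConnectedSet M Y := by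
    refine ⟨hC.isConnectedSet.nonempty.mono hCY, fun A B hAB h ↦ ?_⟩
    rcases hC.isConnectedSet.subset_or_subset h (hAB ▸ hCY) with hCA | hCB
    · exact .inr (hsummand hAB h hCA)
    · exact .inl (hsummand (union_comm B A ▸ hAB) h.symm hCB)
  rwa [hC.eq_of_subset ⟨hYconn, hYF⟩ hCY]

lemma IsComponent.subset_of_mem [Finite α] (hC : IsComponent M F C) (hK : IsConnectedSet M K)
    (hKF : K ⊆ F) (heC : e ∈ C) (heK : e ∈ K) : K ⊆ C :=
  (hK.subset_or_subset hC.skew_sdiff (by rwa [union_sdiff_cancel hC.subset])).resolve_right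
    fun h ↦ (h heK).2 heC

lemma IsComponent.closure_eq [Finite α] [M.Loopless] (hC : IsComponent M F C) (hF : M.IsFlat F) :
    M.closure C = C := by
  have hCE : C ⊆ M.E := hC.subset.trans hF.subset_ground
  exact (hC.eq_of_subset ⟨hC.isConnectedSet.closure hCE, closure_subset_of_isFlat hF hC.subset⟩
    (M.subset_closure C)).symm

end Connectivity

section OrderIso

variable {P Q R : Type*} [PartialOrder P] [PartialOrder Q] [PartialOrder R] [OrderBot P]
  [OrderBot Q] [OrderBot R] (φ : (P × Q) ≃o R) {a : R} {p : P} {q : Q}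

lemma le_map_or_le_map_of_isAtom (ha : IsAtom a) (h : a ≤ φ (p, q)) :
    a ≤ φ (p, ⊥) ∨ a ≤ φ (⊥, q) := by
  obtain ⟨⟨r, s⟩, rfl⟩ := φ.surjective a
  rw [φ.isAtom_iff] at ha
  simp only [φ.le_iff_le, Prod.mk_le_mk] at h ⊢
  rcases ha.le_iff.1 (show (r, ⊥) ≤ (r, s) from ⟨le_rfl, bot_le⟩) with hr | hr
  · exact .inr ⟨(congrArg Prod.fst hr).le, h.2⟩
  · exact .inl ⟨h.1, (congrArg Prod.snd hr).ge⟩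

lemma not_le_map_of_isAtom (ha : IsAtom a) (h : a ≤ φ (p, ⊥)) : ¬ a ≤ φ (⊥, q) := by
  intro h'
  rw [← φ.symm_apply_le] at h h'
  refine ha.1 ((map_eq_bot_iff φ.symm).1 (Prod.ext ?_ ?_))
  · exact le_bot_iff.1 h'.1
  · exact le_bot_iff.1 h.2

end OrderIso

section Flats

variable {α : Type*} {M : Matroid α} {A A' X Y : Set α} {e : α} {F : Flats M}

/-- The flat spanned by `X`. -/
def flatClosure (M : Matroid α) (X : Set α) : Flats M := ⟨M.closure X, M.isFlat_closure X⟩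

lemma flatClosure_le_iff (hX : X ⊆ M.E) : flatClosure M X ≤ F ↔ X ⊆ F.1 :=
  ⟨(M.subset_closure X).trans, closure_subset_of_isFlat F.2⟩

instance : OrderBot (Flats M) where
  bot := flatClosure M ∅
  bot_le _ := (flatClosure_le_iff (empty_subset _)).2 (empty_subset _)

lemma flatClosure_singleton_le_iff (heE : e ∈ M.E) : flatClosure M {e} ≤ F ↔ e ∈ F.1 := by
  rw [flatClosure_le_iff (singleton_subset_iff.2 heE), singleton_subset_iff]

lemma isFlat_of_closure_subset (hX : X ⊆ M.E) (h : M.closure X ⊆ X) : M.IsFlat X :=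
  M.isFlat_iff_closure_eq.2 (h.antisymm (M.subset_closure X))

lemma isFlat_inter (hA : M.IsFlat A) (hA' : M.IsFlat A') : M.IsFlat (A ∩ A') :=
  isFlat_of_closure_subset (inter_subset_left.trans hA.subset_ground)
    (subset_inter (closure_subset_of_isFlat hA inter_subset_left)
      (closure_subset_of_isFlat hA' inter_subset_right))

lemma Skew.isFlat_union (h : Skew M X Y) (hXY : M.IsFlat (X ∪ Y)) (hA : M.IsFlat A)
    (hA' : M.IsFlat A') (hAX : A ⊆ X) (hAY : A' ⊆ Y) : M.IsFlat (A ∪ A') := by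
  refine isFlat_of_closure_subset (union_subset hA.subset_ground hA'.subset_ground) fun e he ↦ ?_
  have heXY : e ∈ X ∪ Y :=
    closure_subset_of_isFlat hXY (union_subset_union hAX hAY) he
  rcases heXY with heX | heY
  · exact .inl (hA.closure ▸ h.mem_closure_left heX hAX hAY he)
  · exact .inr (hA'.closure ▸ h.symm.mem_closure_left heY hAY hAX (union_comm A A' ▸ he))

section Loopless

variable [M.Loopless]

lemma coe_bot_flats : ((⊥ : Flats M) : Set α) = ∅ := M.loops_eq_empty

lemma eq_bot_iff_coe_eq_empty : F = ⊥ ↔ (F : Set α) = ∅ := by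
  rw [← coe_bot_flats (M := M), Subtype.coe_inj]

lemma isAtom_flatClosure_singleton (heE : e ∈ M.E) : IsAtom (flatClosure M {e}) := by
  refine ⟨fun h ↦ ?_, fun F hF ↦ ?_⟩
  · have := eq_bot_iff_coe_eq_empty.1 h
    exact (this ▸ M.mem_closure_self e : e ∈ (∅ : Set α))
  · by_contra hne
    obtain ⟨f, hf⟩ := nonempty_iff_ne_empty.2 (mt eq_bot_iff_coe_eq_empty.2 hne)
    have hfE := F.2.subset_ground hf
    have hef : e ∈ M.closure {f} :=
      (M.isNonloop_of_loopless hfE).mem_closure_singleton (hF.le hf)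
    exact hF.not_ge ((flatClosure_singleton_le_iff heE).2
      (closure_subset_of_isFlat F.2 (singleton_subset_iff.2 hf) hef))

lemma Skew.isFlat_left (h : Skew M X Y) (hXY : M.IsFlat (X ∪ Y)) : M.IsFlat X := by
  have hX : X ⊆ M.E := subset_union_left.trans hXY.subset_ground
  refine isFlat_of_closure_subset hX fun e he ↦ ?_
  have heXY : e ∈ X ∪ Y := closure_subset_of_isFlat hXY subset_union_left he
  exact heXY.resolve_right fun heY ↦ disjoint_left.1 (h.disjoint_closure subset_rfl) he heY

lemma Skew.isFlat_right (h : Skew M X Y) (hXY : M.IsFlat (X ∪ Y)) : M.IsFlat Y :=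
  h.symm.isFlat_left (union_comm X Y ▸ hXY)

end Loopless

/-- A decomposition of a flat into two skew flats is a decomposition of the interval below it. -/
def iicProdOrderIso {Y Z : Flats M} (h : Skew M Y.1 Z.1) (hYZ : Y.1 ∪ Z.1 = F.1) :
    (Iic Y × Iic Z) ≃o Iic F where
  toFun p := ⟨⟨p.1.1.1 ∪ p.2.1.1, h.isFlat_union (hYZ ▸ F.2) p.1.1.2 p.2.1.2 p.1.2 p.2.2⟩,
    (union_subset_union p.1.2 p.2.2).trans hYZ.subset⟩
  invFun G := (⟨⟨G.1.1 ∩ Y.1, isFlat_inter G.1.2 Y.2⟩, inter_subset_right⟩,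
    ⟨⟨G.1.1 ∩ Z.1, isFlat_inter G.1.2 Z.2⟩, inter_subset_right⟩)
  left_inv := by
    rintro ⟨⟨⟨A, hA⟩, hAY⟩, ⟨⟨A', hA'⟩, hAZ⟩⟩
    have hAY : A ⊆ Y.1 := hAY
    have hAZ : A' ⊆ Z.1 := hAZ
    have hA'Y : Disjoint A' Y.1 := h.disjoint.symm.mono_left hAZ
    have hAZ' : Disjoint A Z.1 := h.disjoint.mono_left hAY
    refine Prod.ext (Subtype.ext (Subtype.ext ?_)) (Subtype.ext (Subtype.ext ?_))
    · change (A ∪ A') ∩ Y.1 = A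
      rw [union_inter_distrib_right, inter_eq_left.2 hAY, hA'Y.inter_eq, union_empty]
    · change (A ∪ A') ∩ Z.1 = A'
      rw [union_inter_distrib_right, inter_eq_left.2 hAZ, hAZ'.inter_eq, empty_union]
  right_inv := by
    rintro ⟨⟨A, hA⟩, hAF⟩
    refine Subtype.ext (Subtype.ext ?_)
    change A ∩ Y.1 ∪ A ∩ Z.1 = A
    rw [← inter_union_distrib_left, hYZ, inter_eq_left.2 hAF]
  map_rel_iff' := by
    rintro ⟨⟨⟨A, hA⟩, hAY⟩, ⟨⟨A', hA'⟩, hAZ⟩⟩ ⟨⟨⟨D, hD⟩, hDY⟩, ⟨⟨D', hD'⟩, hDZ⟩⟩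
    change A ∪ A' ⊆ D ∪ D' ↔ A ⊆ D ∧ A' ⊆ D'
    refine ⟨fun hss ↦ ⟨?_, ?_⟩, fun hss ↦ union_subset_union hss.1 hss.2⟩
    · exact (h.disjoint.mono hAY hDZ).subset_left_of_subset_union (subset_union_left.trans hss)
    · exact (h.disjoint.symm.mono hAZ hDY).subset_right_of_subset_union
        (subset_union_right.trans hss)

lemma IsIrred.isConnectedSet [M.Loopless] (hF : IsIrred F) : IsConnectedSet M F.1 := by
  refine ⟨nonempty_iff_ne_empty.2 (mt eq_bot_iff_coe_eq_empty.2 (mt isBot_iff_eq_bot.2 hF.1)),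
    fun Y Z hYZ h ↦ ?_⟩
  by_contra! hne
  let Y' : Flats M := ⟨Y, h.isFlat_left (hYZ ▸ F.2)⟩
  let Z' : Flats M := ⟨Z, h.isFlat_right (hYZ ▸ F.2)⟩
  have hY : Y ⊂ F.1 := by
    refine ssubset_iff_subset_ne.2 ⟨hYZ ▸ subset_union_left, fun heq ↦ hne.2.ne_empty ?_⟩
    exact h.disjoint.symm.eq_bot_of_le (heq ▸ hYZ ▸ subset_union_right)
  have hZ : Z ⊂ F.1 := by
    refine ssubset_iff_subset_ne.2 ⟨hYZ ▸ subset_union_right, fun heq ↦ hne.1.ne_empty ?_⟩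
    exact h.disjoint.eq_bot_of_le (heq ▸ hYZ ▸ subset_union_left)
  exact (hF.2 Y' Z' hY hZ).false (iicProdOrderIso (Y := Y') (Z := Z') h hYZ)

section Product

variable [M.Loopless] {x₁ x₂ : Flats M} (φ : (Iic x₁ × Iic x₂) ≃o Iic F) (p : Iic x₁) (q : Iic x₂)

lemma mem_map_or_mem_map_of_mem {e : α} (he : e ∈ (φ (p, q)).1.1) :
    e ∈ (φ (p, ⊥)).1.1 ∨ e ∈ (φ (⊥, q)).1.1 := by
  have heE : e ∈ M.E := (φ (p, q)).1.2.subset_ground he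
  have hle : flatClosure M {e} ≤ F :=
    ((flatClosure_singleton_le_iff heE).2 he).trans (φ (p, q)).2
  simp only [← flatClosure_singleton_le_iff heE] at he ⊢
  exact le_map_or_le_map_of_isAtom φ (a := ⟨_, hle⟩)
    ((isAtom_flatClosure_singleton heE).Iic hle) he

lemma disjoint_map_map : Disjoint (φ (p, ⊥)).1.1 (φ (⊥, q)).1.1 := by
  refine disjoint_left.2 fun e he he' ↦ ?_
  have heE : e ∈ M.E := (φ (p, ⊥)).1.2.subset_ground he
  have hle : flatClosure M {e} ≤ F :=
    ((flatClosure_singleton_le_iff heE).2 he).trans (φ (p, ⊥)).2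
  rw [← flatClosure_singleton_le_iff heE] at he he'
  exact not_le_map_of_isAtom φ (a := ⟨_, hle⟩)
    ((isAtom_flatClosure_singleton heE).Iic hle) he he'

lemma skew_map_map : Skew M (φ (p, ⊥)).1.1 (φ (⊥, q)).1.1 where
  disjoint := disjoint_map_map φ p q
  indep_union I J hI hJ hI' hJ' := by
    have hIE := hI'.subset_ground
    rw [Matroid.indep_iff_forall_subset_not_isCircuit (union_subset hIE hJ'.subset_ground)]
    intro D hD hDcirc
    obtain ⟨i, hiD, hiJ⟩ := not_subset.1 fun h ↦ hDcirc.not_indep (hJ'.subset h)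
    have hiI : i ∈ I := (hD hiD).resolve_right hiJ
    have hi : i ∈ M.closure (I \ {i} ∪ J) := by
      refine M.closure_subset_closure ?_ (hDcirc.mem_closure_sdiff_singleton_of_mem hiD)
      exact fun x hx ↦ (hD hx.1).imp (⟨·, hx.2⟩) id
    have hle : flatClosure M (I \ {i}) ≤ (φ (p, ⊥)).1 :=
      (flatClosure_le_iff (sdiff_subset.trans hIE)).2 (sdiff_subset.trans hI)
    obtain ⟨⟨r, s⟩, hrs⟩ := φ.surjective ⟨_, hle.trans (φ (p, ⊥)).2⟩
    obtain rfl : s = ⊥ := by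
      have : φ (r, s) ≤ φ (p, ⊥) := hrs ▸ hle
      exact le_bot_iff.1 (φ.le_iff_le.1 this).2
    have hrs' : (φ (r, ⊥)).1.1 = M.closure (I \ {i}) := congrArg (fun G ↦ G.1.1) hrs
    have hir : i ∈ (φ (r, q)).1.1 := by
      have h₁ : φ (r, ⊥) ≤ φ (r, q) := φ.monotone ⟨le_rfl, bot_le⟩
      have h₂ : φ (⊥, q) ≤ φ (r, q) := φ.monotone ⟨bot_le, le_rfl⟩
      have hIr : I \ {i} ⊆ (φ (r, ⊥)).1.1 :=
        hrs' ▸ M.subset_closure _ (sdiff_subset.trans hIE)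
      exact closure_subset_of_isFlat (φ (r, q)).1.2
        (union_subset (hIr.trans h₁) (hJ.trans h₂)) hi
    rcases mem_map_or_mem_map_of_mem φ r q hir with h | h
    · exact hI'.notMem_closure_sdiff_of_mem hiI (hrs' ▸ h)
    · exact (disjoint_map_map φ p q).notMem_of_mem_left (hI hiI) h

end Product

lemma ne_bot_of_iic_prod_orderIso [Finite α] {x₁ x₂ : Flats M}
    (φ : (Iic x₁ × Iic x₂) ≃o Iic F) (hx : x₂ < F) : x₁ ≠ ⊥ := by
  rintro rfl
  have h := Nat.card_congr φ.toEquiv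
  rw [Nat.card_prod, Iic_bot, Nat.card_unique, one_mul, Nat.card_coe_set_eq,
    Nat.card_coe_set_eq] at h
  exact (ncard_lt_ncard (Iic_ssubset_Iic.2 hx)).ne h

lemma IsConnectedSet.isIrred [Finite α] [M.Loopless] (hF : IsConnectedSet M F.1) :
    IsIrred F := by
  refine ⟨mt isBot_iff_eq_bot.1 (mt eq_bot_iff_coe_eq_empty.1 hF.nonempty.ne_empty),
    fun x₁ x₂ hx₁ hx₂ ↦ ⟨fun φ ↦ ?_⟩⟩
  let p : Iic x₁ := ⊤
  let q : Iic x₂ := ⊤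
  have hFpq : F ≤ φ (p, q) := by
    have : (⊤ : Iic F) ≤ φ (p, q) := by rw [← φ.symm_apply_le]; exact ⟨le_top, le_top⟩
    exact this
  have hunion : (φ (p, ⊥)).1.1 ∪ (φ (⊥, q)).1.1 = F.1 :=
    (union_subset (φ (p, ⊥)).2 (φ (⊥, q)).2).antisymm
      fun e he ↦ mem_map_or_mem_map_of_mem φ p q (hFpq he)
  have hbot : ∀ {z}, (φ z).1.1 = ∅ → z = ⊥ := fun {z} hz ↦
    (map_eq_bot_iff φ).1 (Subtype.ext (eq_bot_iff_coe_eq_empty.2 hz))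
  rcases hF.eq_empty_or_eq_empty hunion (skew_map_map φ p q) with h | h
  · exact ne_bot_of_iic_prod_orderIso φ hx₂ (congrArg (·.1.1) (hbot h))
  · exact ne_bot_of_iic_prod_orderIso (OrderIso.prodComm.trans φ) hx₁
      (congrArg (·.2.1) (hbot h))

end Flats

section NestedFlats

variable {α : Type*} {M : Matroid α} {A P S T N : Finset (Flats M)} {C F G : Flats M}
  {I J K X : Set α} {e : α}

/-- The union of a finite set of flats. -/
def flatUnion (S : Finset (Flats M)) : Set α := ⋃ G ∈ S, G.1

lemma mem_flatUnion : e ∈ flatUnion S ↔ ∃ G ∈ S, e ∈ G.1 := by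
  simp [flatUnion]

lemma subset_flatUnion (hG : G ∈ S) : G.1 ⊆ flatUnion S := fun _ he ↦ mem_flatUnion.2 ⟨G, hG, he⟩

lemma flatUnion_subset : flatUnion S ⊆ X ↔ ∀ G ∈ S, G.1 ⊆ X := by
  simp [flatUnion]

lemma flatUnion_mono (h : S ⊆ T) : flatUnion S ⊆ flatUnion T :=
  flatUnion_subset.2 fun _ hG ↦ subset_flatUnion (h hG)

lemma flatUnion_subset_ground (S : Finset (Flats M)) : flatUnion S ⊆ M.E :=
  flatUnion_subset.2 fun G _ ↦ G.2.subset_ground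

lemma flatUnion_subset_closure (S : Finset (Flats M)) : flatUnion S ⊆ M.closure (flatUnion S) :=
  M.subset_closure _ (flatUnion_subset_ground S)

lemma isLUB_flatClosure_flatUnion (S : Finset (Flats M)) :
    IsLUB (S : Set (Flats M)) (flatClosure M (flatUnion S)) :=
  ⟨fun _ hG ↦ (subset_flatUnion hG).trans (flatUnion_subset_closure S), fun _ hF ↦
    (flatClosure_le_iff (flatUnion_subset_ground S)).2 (flatUnion_subset.2 fun _ hG ↦ hF hG)⟩

lemma exists_isAntichain_flatUnion_eq (S : Finset (Flats M)) :
    ∃ A ⊆ S, IsAntichain (· ≤ ·) (A : Set (Flats M)) ∧ flatUnion A = flatUnion S := by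
  classical
  refine ⟨S.filter (Maximal (· ∈ S)), Finset.filter_subset _ S, fun G hG H hH hne hle ↦ ?_,
    (flatUnion_mono (Finset.filter_subset _ S)).antisymm (flatUnion_subset.2 fun G hG ↦ ?_)⟩
  · exact hne ((Finset.mem_filter.1 hG).2.eq_of_le (Finset.mem_filter.1 hH).1 hle)
  · obtain ⟨H, hGH, hH⟩ := S.finite_toSet.exists_le_maximal hG
    exact Subset.trans hGH (subset_flatUnion (Finset.mem_filter.2 ⟨hH.prop, hH⟩))

lemma IsNested.flatClosure_flatUnion_mem (hS : IsNested S)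
    (hirr : IsIrred (flatClosure M (flatUnion S))) : flatClosure M (flatUnion S) ∈ S := by
  obtain ⟨A, hAS, hanti, hA⟩ := exists_isAntichain_flatUnion_eq S
  rw [← hA] at hirr ⊢
  have hlub := isLUB_flatClosure_flatUnion A
  have hcard : A.card ≤ 1 := by
    by_contra! hcard
    obtain ⟨y, hy, hyirr⟩ := hS.2 A hAS hcard hanti
    exact hyirr (hy.unique hlub ▸ hirr)
  rcases Finset.card_le_one_iff_subset_singleton.1 hcard with ⟨H, hH⟩
  rcases Finset.subset_singleton_iff.1 hH with rfl | rfl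
  · exact absurd (isLUB_empty_iff.1 (by simpa using hlub)) hirr.1
  · rw [Finset.coe_singleton] at hlub
    exact hAS (Finset.mem_singleton.2 (hlub.unique isLUB_singleton))

variable [Finite α]

open Classical in
/-- A set of flats together with all maximal irreducible flats. -/
def withMaximal (N : Finset (Flats M)) : Finset (Flats M) :=
  N ∪ (Set.toFinite {C : Flats M | Maximal IsIrred C}).toFinset

lemma mem_withMaximal : G ∈ withMaximal N ↔ G ∈ N ∨ Maximal IsIrred G := by
  simp [withMaximal]

variable [M.Loopless]

lemma IsComponent.subset_closure_flatUnion {D : Set α} [DecidablePred (· ≤ C)]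
    (hC : IsComponent M D C.1) (hS : ∀ G ∈ S, IsIrred G) (hSD : flatUnion S ⊆ D)
    (hD : D ⊆ M.closure (flatUnion S)) :
    C.1 ⊆ M.closure (flatUnion (S.filter (· ≤ C))) := by
  intro e he
  refine hC.skew_sdiff.mem_closure_left he
    (flatUnion_subset.2 fun G hG ↦ (Finset.mem_filter.1 hG).2) subset_rfl ?_
  refine M.closure_subset_closure (flatUnion_subset.2 fun G hG ↦ ?_) (hD (hC.subset he))
  have hGD : G.1 ⊆ D := (subset_flatUnion hG).trans hSD
  rcases (hS G hG).isConnectedSet.subset_or_subset hC.skew_sdiff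
    (by rwa [union_sdiff_cancel hC.subset]) with h | h
  · exact (subset_flatUnion (Finset.mem_filter.2 ⟨hG, h⟩)).trans subset_union_left
  · exact h.trans subset_union_right

lemma IsNested.exists_subset_of_subset_closure (hS : IsNested S) (hK : IsConnectedSet M K)
    (hKS : K ⊆ M.closure (flatUnion S)) : ∃ H ∈ S, K ⊆ H.1 := by
  classical
  obtain ⟨k, hk⟩ := hK.nonempty
  obtain ⟨D, hD, hkD⟩ := exists_isComponent_mem M (hKS hk)
  let C : Flats M := ⟨D, hD.closure_eq (M.isFlat_closure _) ▸ M.isFlat_closure D⟩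
  have hCS : C = flatClosure M (flatUnion (S.filter (· ≤ C))) :=
    le_antisymm (IsComponent.subset_closure_flatUnion (C := C) hD hS.1
      (flatUnion_subset_closure S) subset_rfl)
      ((isLUB_flatClosure_flatUnion _).2 fun G hG ↦ (Finset.mem_filter.1 hG).2)
  have hC : C ∈ S.filter (· ≤ C) := by
    have hirr : IsIrred C := IsConnectedSet.isIrred hD.isConnectedSet
    rw [hCS] at hirr
    have hmem := (hS.mono (Finset.filter_subset _ S)).flatClosure_flatUnion_mem hirr
    rwa [← hCS] at hmem
  exact ⟨C, (Finset.mem_filter.1 hC).1, hD.subset_of_mem hK hKS hkD hk⟩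

lemma IsNested.skew_flatUnion (hP : IsNested P) (hS : S ⊆ P) (hG : G ∈ P)
    (hinc : ∀ H ∈ S, ¬ H ≤ G ∧ ¬ G ≤ H) : Skew M G.1 (flatUnion S) := by
  classical
  set F := M.closure (flatUnion (insert G S))
  have hSF : ∀ H ∈ insert G S, H.1 ⊆ F := fun H hH ↦
    (subset_flatUnion hH).trans (flatUnion_subset_closure _)
  have hGF := hSF G (Finset.mem_insert_self G S)
  have hGc : IsConnectedSet M G.1 := (hP.1 G hG).isConnectedSet
  obtain ⟨e, he⟩ := hGc.nonempty
  obtain ⟨C, hC, heC⟩ := exists_isComponent_mem M (hGF he)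
  obtain ⟨H, hH, hCH⟩ := (hP.mono (Finset.insert_subset hG hS)).exists_subset_of_subset_closure
    hC.isConnectedSet hC.subset
  have hGC : G.1 ⊆ C := hC.subset_of_mem hGc hGF heC he
  obtain rfl : H = G := (Finset.mem_insert.1 hH).resolve_right fun hHS ↦
    (hinc H hHS).2 (hGC.trans hCH)
  obtain rfl : C = H.1 := hCH.antisymm hGC
  refine hC.skew_sdiff.mono subset_rfl (flatUnion_subset.2 fun K hK ↦ ?_)
  refine ((hP.1 K (hS hK)).isConnectedSet.subset_or_subset hC.skew_sdiff ?_).resolve_left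
    (hinc K hK).1
  rw [union_sdiff_cancel hC.subset]
  exact hSF K (Finset.mem_insert_of_mem hK)

lemma IsNested.le_or_le_of_mem (hP : IsNested P) (hF : F ∈ P) (hG : G ∈ P) (heF : e ∈ F.1)
    (heG : e ∈ G.1) : F ≤ G ∨ G ≤ F := by
  by_contra! hcon
  have hskew := hP.skew_flatUnion (Finset.singleton_subset_iff.2 hG) hF
    (by simpa using ⟨hcon.2, hcon.1⟩)
  exact Set.disjoint_left.1 hskew.disjoint heF (mem_flatUnion.2 ⟨G, by simp, heG⟩)

lemma IsNested.exists_forall_mem_iff_le (hP : IsNested P) (he : e ∈ flatUnion P) :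
    ∃ G ∈ P, ∀ K ∈ P, e ∈ K.1 ↔ G ≤ K := by
  classical
  obtain ⟨G₀, hG₀, heG₀⟩ := mem_flatUnion.1 he
  obtain ⟨G, -, hG⟩ := (P.filter fun G ↦ e ∈ G.1).finite_toSet.exists_le_minimal
    (Finset.mem_filter.2 ⟨hG₀, heG₀⟩)
  obtain ⟨hGP, heG⟩ := Finset.mem_filter.1 hG.prop
  refine ⟨G, hGP, fun K hK ↦ ⟨fun heK ↦ ?_, fun hle ↦ hle heG⟩⟩
  by_contra hGK
  have hKG : ¬ K ≤ G := fun hKG ↦ hGK (hG.le_of_le (Finset.mem_filter.2 ⟨hK, heK⟩) hKG)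
  have hskew := hP.skew_flatUnion (S := {K}) (by simpa using hK) hGP (by simpa using ⟨hKG, hGK⟩)
  exact hskew.disjoint.notMem_of_mem_left heG (mem_flatUnion.2 ⟨K, by simp, heK⟩)

lemma IsNested.exists_generic_element (hP : IsNested P) (hG : G ∈ P) :
    ∃ e, ∀ K ∈ P, e ∈ K.1 ↔ G ≤ K := by
  classical
  by_contra! hcon
  have hsub : G.1 ⊆ flatUnion (P.filter fun K ↦ ¬ G ≤ K) := by
    intro e he
    obtain ⟨K, hK, h | h⟩ := hcon e
    · exact mem_flatUnion.2 ⟨K, Finset.mem_filter.2 ⟨hK, h.2⟩, h.1⟩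
    · exact absurd (h.2 he) h.1
  obtain ⟨H, hH, hGH⟩ := (hP.mono (Finset.filter_subset _ P)).exists_subset_of_subset_closure
    (hP.1 G hG).isConnectedSet (hsub.trans (flatUnion_subset_closure _))
  exact (Finset.mem_filter.1 hH).2 hGH

lemma maximal_isIrred_iff_isComponent : Maximal IsIrred C ↔ IsComponent M M.E C.1 := by
  constructor
  · intro hC
    refine ⟨⟨hC.prop.isConnectedSet, C.2.subset_ground⟩, fun K hK hCK ↦ ?_⟩
    have hle := hC.le_of_ge (y := flatClosure M K) (IsConnectedSet.isIrred (hK.1.closure hK.2))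
      (Subset.trans hCK (M.subset_closure K hK.2))
    exact (flatClosure_le_iff hK.2).1 hle
  · intro hC
    exact ⟨hC.isConnectedSet.isIrred, fun K hK hCK ↦
      (hC.eq_of_subset ⟨hK.isConnectedSet, K.2.subset_ground⟩ hCK).ge⟩

lemma exists_maximal_isIrred_mem (he : e ∈ M.E) : ∃ C : Flats M, Maximal IsIrred C ∧ e ∈ C.1 := by
  obtain ⟨C, hC, heC⟩ := exists_isComponent_mem M he
  let C' : Flats M := ⟨C, hC.closure_eq M.ground_isFlat ▸ M.isFlat_closure C⟩
  exact ⟨C', maximal_isIrred_iff_isComponent.2 hC, heC⟩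

lemma not_isIrred_flatClosure_flatUnion {D : Set α} (hcard : 1 < A.card)
    (hA : IsAntichain (· ≤ ·) (A : Set (Flats M))) (hCA : C ∈ A) (hC : IsComponent M D C.1)
    (hD : M.closure (flatUnion A) ⊆ D) : ¬ IsIrred (flatClosure M (flatUnion A)) := by
  intro hirr
  have hub := (isLUB_flatClosure_flatUnion A).1
  obtain ⟨K, hK, hKC⟩ := Finset.exists_mem_ne hcard C
  obtain ⟨e, he⟩ := hC.isConnectedSet.nonempty
  exact hA hK hCA hKC
    ((hub hK).trans (hC.subset_of_mem hirr.isConnectedSet hD he (hub hCA he)))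

lemma IsNested.withMaximal (hN : IsNested N) : IsNested (withMaximal N) := by
  refine ⟨fun G hG ↦ (mem_withMaximal.1 hG).elim (hN.1 G) Maximal.prop,
    fun A hA hcard hanti ↦ ?_⟩
  by_cases hAN : A ⊆ N
  · exact hN.2 A hAN hcard hanti
  · obtain ⟨C, hCA, hCN⟩ := Finset.not_subset.1 hAN
    have hC := maximal_isIrred_iff_isComponent.1 ((mem_withMaximal.1 (hA hCA)).resolve_left hCN)
    exact ⟨_, isLUB_flatClosure_flatUnion A,
      not_isIrred_flatClosure_flatUnion hcard hanti hCA hC (M.closure_subset_ground _)⟩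

lemma flatUnion_withMaximal (N : Finset (Flats M)) : flatUnion (withMaximal N) = M.E := by
  refine (flatUnion_subset_ground _).antisymm fun e he ↦ ?_
  obtain ⟨C, hC, heC⟩ := exists_maximal_isIrred_mem he
  exact mem_flatUnion.2 ⟨C, mem_withMaximal.2 (.inr hC), heC⟩

end NestedFlats

section Adapted

variable {α : Type*} {M : Matroid α} {P S : Finset (Flats M)} {G : Flats M} {I J : Set α} {e : α}

/-- `I` contains a spanning subset of every member of `S`. -/
def IsAdapted (S : Finset (Flats M)) (I : Set α) : Prop :=
  ∀ G ∈ S, G.1 ⊆ M.closure (I ∩ G.1)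

lemma IsAdapted.mono (hI : IsAdapted S I) (hIJ : I ⊆ J) : IsAdapted S J := fun G hG ↦
  (hI G hG).trans (M.closure_subset_closure (inter_subset_inter_left _ hIJ))

variable [Finite α] [M.Loopless]

/-- The part of `S` not below `G` is skew to `G`, so any basis of the new union contains a basis
of `G`. -/
lemma IsNested.exists_isAdapted_insert [DecidableEq (Flats M)] (hP : IsNested P) (hS : S ⊆ P)
    (hG : G ∈ P) (hGS : ∀ H ∈ S, ¬ G ≤ H) (hI : M.Indep I) (hIS : I ⊆ flatUnion (insert G S))
    (hIa : IsAdapted S I) :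
    ∃ J, I ⊆ J ∧ J ⊆ flatUnion (insert G S) ∧ M.Indep J ∧ IsAdapted (insert G S) J := by
  classical
  obtain ⟨J, hJ, hIJ⟩ := hI.subset_isBasis_of_subset hIS (flatUnion_subset_ground _)
  refine ⟨J, hIJ, hJ.subset, hJ.indep, fun H hH ↦ ?_⟩
  rcases Finset.mem_insert.1 hH with rfl | hH
  · have hskew : Skew M H.1 (flatUnion (S.filter (¬ · ≤ H))) := hP.skew_flatUnion
      ((Finset.filter_subset _ _).trans hS) hG
      fun K hK ↦ ⟨(Finset.mem_filter.1 hK).2, hGS K (Finset.mem_filter.1 hK).1⟩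
    have hJH : J \ H.1 ⊆ flatUnion (S.filter (¬ · ≤ H)) := by
      rintro f ⟨hfJ, hfH⟩
      obtain ⟨K, hK, hfK⟩ := mem_flatUnion.1 (hJ.subset hfJ)
      rcases Finset.mem_insert.1 hK with rfl | hK
      · exact absurd hfK hfH
      · exact mem_flatUnion.2 ⟨K, Finset.mem_filter.2 ⟨hK, fun hle ↦ hfH (hle hfK)⟩, hfK⟩
    refine fun e he ↦ hskew.mem_closure_left he inter_subset_right hJH ?_
    rw [inter_union_sdiff]
    exact hJ.subset_closure (subset_flatUnion (Finset.mem_insert_self _ _) he)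
  · exact hIa.mono hIJ H hH

lemma IsNested.exists_isAdapted_extension (hP : IsNested P) (hS : S ⊆ P)
    (hlow : ∀ H ∈ S, ∀ K ∈ P, K ≤ H → K ∈ S) (hI : M.Indep I) (hIS : I ⊆ flatUnion S)
    (hIa : IsAdapted S I) : ∃ J, I ⊆ J ∧ J ⊆ flatUnion P ∧ M.Indep J ∧ IsAdapted P J := by
  classical
  induction P using Finset.strongInduction with
  | _ P ih =>
    rcases (P \ S).eq_empty_or_nonempty with hPS | ⟨G₀, hG₀⟩
    · obtain rfl := hS.antisymm (Finset.sdiff_eq_empty_iff_subset.1 hPS)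
      exact ⟨I, subset_rfl, hIS, hI, hIa⟩
    obtain ⟨G, -, hG⟩ := (P \ S).finite_toSet.exists_le_maximal hG₀
    obtain ⟨hGP, hGS⟩ := Finset.mem_sdiff.1 hG.prop
    have hSG : S ⊆ P.erase G := Finset.subset_erase.2 ⟨hS, hGS⟩
    obtain ⟨J, hIJ, hJP, hJ, hJa⟩ := ih _ (Finset.erase_ssubset hGP)
      (hP.mono (P.erase_subset G)) hSG fun H hH K hK ↦ hlow H hH K (Finset.mem_of_mem_erase hK)
    have hGmax : ∀ H ∈ P.erase G, ¬ G ≤ H := fun H hH hGH ↦ by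
      obtain ⟨hHG, hHP⟩ := Finset.mem_erase.1 hH
      have hHS : H ∉ S := fun hHS ↦ hGS (hlow H hHS G hGP hGH)
      exact hHG (hG.eq_of_le (Finset.mem_sdiff.2 ⟨hHP, hHS⟩) hGH).symm
    obtain ⟨J', hJJ', hJ'⟩ := hP.exists_isAdapted_insert (P.erase_subset G) hGP hGmax hJ
      (hJP.trans (flatUnion_mono (Finset.subset_insert _ _))) hJa
    rw [Finset.insert_erase hGP] at hJ'
    exact ⟨J', hIJ.trans hJJ', hJ'⟩

lemma IsNested.exists_isBase_isAdapted_superset (hP : IsNested P) (hS : S ⊆ P)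
    (hlow : ∀ H ∈ S, ∀ K ∈ P, K ≤ H → K ∈ S) (hI : M.Indep I) (hIS : I ⊆ flatUnion S)
    (hIa : IsAdapted S I) : ∃ X, M.IsBase X ∧ I ⊆ X ∧ IsAdapted P X := by
  obtain ⟨J, hIJ, -, hJ, hJa⟩ := hP.exists_isAdapted_extension hS hlow hI hIS hIa
  obtain ⟨X, hX, hJX⟩ := hJ.exists_isBase_superset
  exact ⟨X, hX, hIJ.trans hJX, hJa.mono hJX⟩

lemma IsNested.exists_isBase_isAdapted (hP : IsNested P) : ∃ X, M.IsBase X ∧ IsAdapted P X := by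
  obtain ⟨X, hX, -, hXa⟩ := hP.exists_isBase_isAdapted_superset (Finset.empty_subset P)
    (by simp) M.empty_indep (empty_subset _) (fun G hG ↦ absurd hG (Finset.notMem_empty G))
  exact ⟨X, hX, hXa⟩

lemma IsNested.exists_isBase_isAdapted_mem (hP : IsNested P) (he : e ∈ flatUnion P) :
    ∃ X, M.IsBase X ∧ e ∈ X ∧ IsAdapted P X := by
  classical
  obtain ⟨G, hG, hGe⟩ := hP.exists_forall_mem_iff_le he
  set S := P.filter fun H ↦ e ∉ H.1
  have hSP : S ⊆ P := Finset.filter_subset _ _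
  have hSe : ∀ H ∈ S, e ∉ H.1 := fun H hH ↦ (Finset.mem_filter.1 hH).2
  obtain ⟨I, -, hIS, hI, hIa⟩ := (hP.mono hSP).exists_isAdapted_extension (Finset.empty_subset S)
    (by simp) M.empty_indep (empty_subset _) (fun G hG ↦ absurd hG (Finset.notMem_empty G))
  have heI : e ∉ M.closure I := fun heI ↦ by
    obtain ⟨H, hH, heH⟩ := (hP.mono hSP).exists_subset_of_subset_closure
      (isConnectedSet_singleton M e) (singleton_subset_iff.2 (M.closure_subset_closure hIS heI))
    exact hSe H hH (heH rfl)
  obtain ⟨J, hIJ, hJS, hJ, hJa⟩ := hP.exists_isAdapted_insert hSP hG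
    (fun H hH hle ↦ hSe H hH ((hGe H (hSP hH)).2 hle))
    (hI.insert_indep_iff.2 (.inl ⟨flatUnion_subset_ground P he, heI⟩))
    (insert_subset (subset_flatUnion (Finset.mem_insert_self _ _) ((hGe G hG).2 le_rfl))
      (hIS.trans (flatUnion_mono (Finset.subset_insert _ _))))
    (hIa.mono (subset_insert _ _))
  have hlow : ∀ H ∈ insert G S, ∀ K ∈ P, K ≤ H → K ∈ insert G S := by
    intro H hH K hK hKH
    by_cases heK : e ∈ K.1
    · rcases Finset.mem_insert.1 hH with rfl | hH
      · exact Finset.mem_insert.2 (.inl (le_antisymm hKH ((hGe K hK).1 heK)))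
      · exact absurd (hKH heK) (hSe H hH)
    · exact Finset.mem_insert_of_mem (Finset.mem_filter.2 ⟨hK, heK⟩)
  obtain ⟨X, hX, hJX, hXa⟩ := hP.exists_isBase_isAdapted_superset (Finset.insert_subset hG hSP)
    hlow hJ hJS hJa
  exact ⟨X, hX, hJX (hIJ (mem_insert _ _)), hXa⟩

end Adapted

section FlatComb

variable {α : Type*} [Fintype α] {M : Matroid α} {P : Finset (Flats M)} {G : Flats M}
  {a b : Flats M → ℝ} {e f : α}

/-- The combination `∑ a_G 1_G` of the indicator vectors of the flats of `M`. -/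
def flatComb : (Flats M → ℝ) →ₗ[ℝ] (α → ℝ) :=
  ∑ G : Flats M, (LinearMap.proj G).smulRight ((G : Set α).indicator 1)

lemma flatComb_apply (a : Flats M → ℝ) (e : α) :
    flatComb a e = ∑ G : Flats M, (G : Set α).indicator (fun _ ↦ a G) e := by
  simp only [flatComb, LinearMap.sum_apply, Finset.sum_apply]
  refine Finset.sum_congr rfl fun G _ ↦ ?_
  by_cases he : e ∈ G.1 <;> simp [he]

lemma flatComb_congr (ha : ∀ G ∉ P, a G = 0) (hef : ∀ K ∈ P, e ∈ K.1 ↔ f ∈ K.1) :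
    flatComb a e = flatComb a f := by
  classical
  rw [flatComb_apply, flatComb_apply]
  refine Finset.sum_congr rfl fun K _ ↦ ?_
  by_cases hK : K ∈ P
  · simp only [indicator_apply, hef K hK]
  · simp only [ha K hK, indicator_zero]

lemma flatComb_eq_sum [DecidablePred (G ≤ ·)] (ha : ∀ K ∉ P, a K = 0)
    (he : ∀ K ∈ P, e ∈ K.1 ↔ G ≤ K) : flatComb a e = ∑ K ∈ P with G ≤ K, a K := by
  classical
  rw [flatComb_apply, Finset.sum_filter, ← Finset.sum_subset (Finset.subset_univ P)
    fun K _ hK ↦ by rw [ha K hK, indicator_zero]]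
  exact Finset.sum_congr rfl fun K hK ↦ by simp only [indicator_apply, he K hK]

lemma weight_neg_flatComb (a : Flats M → ℝ) (X : Set α) :
    weight (-flatComb a) X = -∑ G, a G * (X ∩ G.1).ncard := by
  classical
  have hcard (G : Flats M) :
      ∑ e, X.indicator (G.1.indicator fun _ ↦ a G) e = a G * (X ∩ G.1).ncard := by
    rw [indicator_indicator, Finset.sum_indicator_eq_sum_filter, Finset.sum_const, nsmul_eq_mul,
      mul_comm, ncard_eq_toFinset_card', filter_mem_univ_eq_toFinset]
  simp only [← hcard]
  rw [weight, Finset.sum_comm, ← Finset.sum_neg_distrib]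
  refine Finset.sum_congr rfl fun e _ ↦ ?_
  by_cases he : e ∈ X <;> simp [he, flatComb_apply]

variable [M.Loopless]

lemma IsNested.eq_of_flatComb_eq (hP : IsNested P) (ha : ∀ G ∉ P, a G = 0)
    (hb : ∀ G ∉ P, b G = 0) (hab : flatComb a = flatComb b) : a = b := by
  classical
  funext G
  induction G using WellFoundedGT.induction with
  | ind G ih =>
    by_cases hG : G ∈ P
    · obtain ⟨e, he⟩ := hP.exists_generic_element hG
      have hsum := congrFun hab e
      have hmem : G ∈ P.filter (G ≤ ·) := Finset.mem_filter.2 ⟨hG, le_rfl⟩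
      rw [flatComb_eq_sum ha he, flatComb_eq_sum hb he, ← Finset.add_sum_erase _ _ hmem,
        ← Finset.add_sum_erase _ _ hmem] at hsum
      have habove : ∑ K ∈ (P.filter (G ≤ ·)).erase G, a K =
          ∑ K ∈ (P.filter (G ≤ ·)).erase G, b K := by
        refine Finset.sum_congr rfl fun K hK ↦ ih K ?_
        rw [Finset.mem_erase, Finset.mem_filter] at hK
        exact lt_of_le_of_ne hK.2.2 hK.1.symm
      linarith
    · rw [ha G hG, hb G hG]

open Function in
/-- Both sides have the dimension of the number of members of `P`, so surjectivity follows from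
injectivity. -/
lemma IsNested.exists_flatComb_eq (hP : IsNested P) (hcov : flatUnion P = univ) {ν : α → ℝ}
    (hν : ∀ e f, (∀ K ∈ P, e ∈ K.1 ↔ f ∈ K.1) → ν e = ν f) :
    ∃ b : Flats M → ℝ, (∀ G ∉ P, b G = 0) ∧ ν = flatComb b := by
  choose g hg using fun G : P ↦ hP.exists_generic_element G.2
  have hrep (e : α) : ∃ G : P, ∀ K ∈ P, e ∈ K.1 ↔ g G ∈ K.1 := by
    obtain ⟨G, hG, hGe⟩ := hP.exists_forall_mem_iff_le (hcov ▸ mem_univ e)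
    exact ⟨⟨G, hG⟩, fun K hK ↦ (hGe K hK).trans (hg ⟨G, hG⟩ K hK).symm⟩
  have hsupp (c : P → ℝ) : ∀ G ∉ P, extend Subtype.val c 0 G = 0 := fun G hG ↦
    extend_apply' _ _ _ fun ⟨K, hK⟩ ↦ hG (hK ▸ K.2)
  let T : (P → ℝ) →ₗ[ℝ] (P → ℝ) :=
    LinearMap.funLeft ℝ ℝ g ∘ₗ flatComb ∘ₗ ExtendByZero.linearMap ℝ Subtype.val
  have hT : Injective T := fun c d hcd ↦ by
    refine extend_injective Subtype.val_injective (0 : Flats M → ℝ)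
      (hP.eq_of_flatComb_eq (hsupp c) (hsupp d) ?_)
    funext e
    obtain ⟨G, hG⟩ := hrep e
    rw [flatComb_congr (hsupp c) hG, flatComb_congr (hsupp d) hG]
    exact congrFun hcd G
  obtain ⟨c, hc⟩ := LinearMap.injective_iff_surjective.1 hT fun G ↦ ν (g G)
  refine ⟨extend Subtype.val c 0, hsupp c, funext fun e ↦ ?_⟩
  obtain ⟨G, hG⟩ := hrep e
  rw [hν e _ hG, flatComb_congr (hsupp c) hG]
  exact (congrFun hc G).symm

end FlatComb

section Exchange

variable {α : Type*} {M : Matroid α} {F G I J T T' X Y : Set α} {f : α}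

lemma ncard_le_ncard_of_subset_closure [Finite α] (hI : M.Indep I) (hJ : M.Indep J)
    (hIJ : I ⊆ M.closure J) : I.ncard ≤ J.ncard := by
  have hle : I.encard ≤ J.encard := by
    rw [← hI.eRk_eq_encard, ← hJ.eRk_eq_encard, ← M.eRk_closure_eq J]
    exact M.eRk_mono hIJ
  exact ENat.toNat_le_toNat hle J.toFinite.encard_lt_top.ne

lemma subset_closure_of_ncard_le_ncard [Finite α] (hI : M.Indep I) (hJ : M.Indep J)
    (hIJ : I ⊆ M.closure J) (hcard : J.ncard ≤ I.ncard) : J ⊆ M.closure I := by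
  have hle : M.eRk (M.closure J) ≤ M.eRk I := by
    rw [M.eRk_closure_eq, hI.eRk_eq_encard, hJ.eRk_eq_encard, ← J.toFinite.cast_ncard_eq,
      ← I.toFinite.cast_ncard_eq]
    exact Nat.cast_le.2 hcard
  have hcl := (M.isRkFinite_set I).closure_eq_closure_of_subset_of_eRk_ge_eRk hIJ hle
  rw [hcl, M.closure_closure]
  exact M.subset_closure J hJ.subset_ground

lemma skew_of_isBasis (hI : M.IsBasis I X) (hJ : M.IsBasis J Y) (hIJ : M.Indep (I ∪ J))
    (hd : Disjoint X Y) : Skew M X Y where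
  disjoint := hd
  indep_union K L hKX hLY hK hL := by
    obtain ⟨K', hK', hKK'⟩ := hK.subset_isBasis_of_subset hKX hI.subset_ground
    obtain ⟨L', hL', hLL'⟩ := hL.subset_isBasis_of_subset hLY hJ.subset_ground
    have hK'J : M.Indep (J ∪ K') :=
      (hK'.contract_indep_iff.1 (hI.contract_indep_iff.2
        ⟨union_comm I J ▸ hIJ, hd.mono_right hJ.subset⟩)).1
    have hK'L' : M.Indep (K' ∪ L') :=
      (hL'.contract_indep_iff.1 (hJ.contract_indep_iff.2
        ⟨union_comm J K' ▸ hK'J, hd.symm.mono_right hK'.subset⟩)).1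
    exact hK'L'.subset (union_subset_union hKK' hLL')

lemma isBasis_contract_inter (hX : M.Indep X) (hF : F ⊆ M.closure (X ∩ F))
    (hT : T ⊆ M.closure (X ∩ (F ∪ T))) (hFT : Disjoint F T) :
    (M ／ F).IsBasis (X ∩ T) T := by
  have hbasis : M.IsBasis (X ∩ F) F :=
    (hX.inter_right F).isBasis_of_subset_of_subset_closure inter_subset_right hF
  refine Matroid.Indep.isBasis_of_subset_of_subset_closure ?_ inter_subset_right fun x hx ↦ ?_
  · exact hbasis.contract_indep_iff.2
      ⟨hX.subset (union_subset inter_subset_left inter_subset_left),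
        hFT.mono_right inter_subset_right⟩
  · rw [M.contract_closure_eq]
    refine ⟨M.closure_subset_closure ?_ (hT hx), hFT.notMem_of_mem_right hx⟩
    rintro y ⟨hyX, hyF | hyT⟩
    exacts [.inr hyF, .inl ⟨hyX, hyT⟩]

lemma skew_contract (hX : M.Indep X) (hF : F ⊆ M.closure (X ∩ F))
    (hT : T ⊆ M.closure (X ∩ (F ∪ T))) (hT' : T' ⊆ M.closure (X ∩ (F ∪ T')))
    (hFT : Disjoint F (T ∪ T')) (hTT' : Disjoint T T') : Skew (M ／ F) T T' := by
  obtain ⟨hFT, hFT'⟩ := disjoint_union_right.1 hFT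
  have hbasis : M.IsBasis (X ∩ F) F :=
    (hX.inter_right F).isBasis_of_subset_of_subset_closure inter_subset_right hF
  refine skew_of_isBasis (isBasis_contract_inter hX hF hT hFT)
    (isBasis_contract_inter hX hF hT' hFT') (hbasis.contract_indep_iff.2 ⟨?_, ?_⟩) hTT'
  · exact hX.subset (union_subset (union_subset inter_subset_left inter_subset_left)
      inter_subset_left)
  · exact disjoint_union_right.2
      ⟨hFT.mono_right inter_subset_right, hFT'.mono_right inter_subset_right⟩

lemma exists_isBase_exchange (hX : M.IsBase X) (hG : G ⊆ M.closure (X ∩ G))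
    (hT : T ∪ T' = G \ F) (hf : f ∈ T') (hfX : f ∉ M.closure (X ∩ (F ∪ T'))) :
    ∃ e ∈ T, e ∈ X ∧ f ∉ X ∧ M.IsBase (insert f (X \ {e})) := by
  have hfG : f ∈ G := (hT ▸ .inr hf : f ∈ G \ F).1
  have hfE : f ∈ M.E := M.closure_subset_ground _ (hG hfG)
  have hfX' : f ∉ X := fun h ↦ hfX (M.mem_closure_of_mem' ⟨h, .inr hf⟩ hfE)
  have hfXG : f ∉ X ∩ G := fun h ↦ hfX' h.1
  have hcirc := (hX.indep.inter_right G).fundCircuit_isCircuit (hG hfG) hfXG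
  have hsub : M.fundCircuit f (X ∩ G) ⊆ insert f (X ∩ G) := M.fundCircuit_subset_insert f _
  obtain ⟨e, ⟨heC, hef⟩, heT⟩ : ∃ e ∈ M.fundCircuit f (X ∩ G) \ {f}, e ∈ T := by
    by_contra! hcon
    refine hfX (M.closure_subset_closure (fun e he ↦ ?_)
      (hcirc.mem_closure_sdiff_singleton_of_mem (M.mem_fundCircuit f _)))
    have heXG : e ∈ X ∩ G := (hsub he.1).resolve_left he.2
    refine ⟨heXG.1, or_iff_not_imp_left.2 fun heF ↦ ?_⟩
    exact (hT.symm ▸ ⟨heXG.2, heF⟩ : e ∈ T ∪ T').resolve_left (hcon e he)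
  have heX : e ∈ X := ((hsub heC).resolve_left hef).1
  rw [hcirc.eq_fundCircuit_of_subset hX.indep
    (hsub.trans (insert_subset_insert inter_subset_left)),
    hX.indep.mem_fundCircuit_iff (by rwa [hX.closure_eq]) hfX',
    insert_sdiff_of_notMem _ (by simpa using Ne.symm hef)] at heC
  exact ⟨e, heT, heX, hfX', hX.exchange_isBase_of_indep hfX' heC⟩

lemma eq_of_isConnectedSet_contract {β : Type*} (hc : IsConnectedSet (M ／ F) (G \ F))
    (hX : M.IsBase X) (hF : F ⊆ M.closure (X ∩ F)) (hG : G ⊆ M.closure (X ∩ G)) {ν : α → β}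
    (hν : ∀ x ∈ G \ F, ∀ y ∈ G \ F, x ∈ X → y ∉ X → M.IsBase (insert y (X \ {x})) → ν x = ν y)
    {e : α} (he : e ∈ G \ F) (hf : f ∈ G \ F) : ν e = ν f := by
  by_contra hne
  set T := {x ∈ G \ F | ν x = ν e}
  set T' := {x ∈ G \ F | ν x ≠ ν e}
  have hTT' : T ∪ T' = G \ F := by
    ext x
    simp only [T, T', mem_union, mem_ofPred_eq]
    tauto
  have hT : T ⊆ M.closure (X ∩ (F ∪ T)) := fun y hy ↦ by
    by_contra hyX
    obtain ⟨x, hx, hxX, hyX', hb⟩ :=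
      exists_isBase_exchange hX hG (union_comm T T' ▸ hTT') hy hyX
    exact hx.2 ((hν x hx.1 y hy.1 hxX hyX' hb).trans hy.2)
  have hT' : T' ⊆ M.closure (X ∩ (F ∪ T')) := fun y hy ↦ by
    by_contra hyX
    obtain ⟨x, hx, hxX, hyX', hb⟩ := exists_isBase_exchange hX hG hTT' hy hyX
    exact hy.2 ((hν x hx.1 y hy.1 hxX hyX' hb).symm.trans hx.2)
  have hskew : Skew (M ／ F) T T' := skew_contract hX.indep hF hT hT'
    (hTT' ▸ disjoint_sdiff_right) (disjoint_left.2 fun x hx hx' ↦ hx'.2 hx.2)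
  rcases hc.eq_empty_or_eq_empty hTT' hskew with h | h
  · exact notMem_empty e (h ▸ ⟨he, rfl⟩)
  · exact notMem_empty f (h ▸ ⟨hf, Ne.symm hne⟩)

end Exchange

section MinBase

variable {α : Type*} [Fintype α] {M : Matroid α} {X : Set α} {ω ν : α → ℝ} {x y : α}

lemma weight_add (ω ν : α → ℝ) (X : Set α) : weight (ω + ν) X = weight ω X + weight ν X := by
  simp [weight, indicator_add', Finset.sum_add_distrib]

lemma weight_smul (r : ℝ) (ω : α → ℝ) (X : Set α) : weight (r • ω) X = r * weight ω X := by
  classical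
  simp [weight, indicator_apply, Finset.mul_sum]

lemma initialMatroid_eq_iff :
    initialMatroid M ω = initialMatroid M ν ↔ ∀ X, IsMinBase M ω X ↔ IsMinBase M ν X :=
  ⟨fun h X ↦ iff_of_eq (congrArg (·.IsBase X) h), fun h ↦ Matroid.ext_isBase rfl fun X _ ↦ h X⟩

lemma initialMatroid_loopless_iff :
    (initialMatroid M ω).Loopless ↔ ∀ e ∈ M.E, ∃ X, IsMinBase M ω X ∧ e ∈ X := by
  rw [Matroid.loopless_iff_forall_isNonloop]
  refine ⟨fun h e he ↦ (h e he).exists_mem_isBase, fun h e he ↦ ?_⟩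
  obtain ⟨X, hX, heX⟩ := h e he
  exact Matroid.IsBase.indep (M := initialMatroid M ω) hX |>.isNonloop_of_mem heX

lemma isMinBase_smul_add_smul_iff (hων : ∀ X, IsMinBase M ω X ↔ IsMinBase M ν X) {r s : ℝ}
    (hr : 0 ≤ r) (hs : 0 < s) : IsMinBase M (r • ω + s • ν) X ↔ IsMinBase M ν X := by
  simp only [IsMinBase, weight_add, weight_smul]
  refine ⟨fun hX ↦ ⟨hX.1, ?_⟩, fun hX ↦ ⟨hX.1, fun Z hZ ↦ ?_⟩⟩
  · obtain ⟨Y, hY⟩ := exists_isMinBase M ν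
    have hωY : r * weight ω Y ≤ r * weight ω X :=
      mul_le_mul_of_nonneg_left (((hων Y).2 hY).2 X hX.1) hr
    have hνX : weight ν X ≤ weight ν Y := le_of_mul_le_mul_left (by linarith [hX.2 Y hY.1]) hs
    exact fun Z hZ ↦ hνX.trans (hY.2 Z hZ)
  · exact add_le_add (mul_le_mul_of_nonneg_left (((hων X).2 hX).2 Z hZ) hr)
      (mul_le_mul_of_nonneg_left (hX.2 Z hZ) hs.le)

lemma IsMinBase.eq_of_exchange (hX : IsMinBase M ω X)
    (hων : ∀ X, IsMinBase M ω X ↔ IsMinBase M ν X) (hx : x ∈ X) (hy : y ∉ X)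
    (hbase : M.IsBase (insert y (X \ {x}))) (hω : ω x = ω y) : ν x = ν y := by
  have hY : IsMinBase M ω (insert y (X \ {x})) := by
    refine ⟨hbase, fun Z hZ ↦ ?_⟩
    rw [weight_exchange ω hx hy, hω, sub_add_cancel]
    exact hX.2 Z hZ
  have hXY := ((hων X).1 hX).2 _ hbase
  have hYX := ((hων _).1 hY).2 _ hX.1
  rw [weight_exchange ν hx hy] at hXY hYX
  linarith

end MinBase

section AdaptedBase

variable {α : Type*} {M : Matroid α} {P S : Finset (Flats M)} {G : Flats M} {X Y : Set α} {x : α}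

/-- The contraction of a connected flat by a smaller flat is connected. -/
def HasConnectedContractions (M : Matroid α) : Prop :=
  ∀ ⦃F G⦄, M.IsFlat F → M.IsFlat G → F ⊂ G → IsConnectedSet M G →
    IsConnectedSet (M ／ F) (G \ F)

lemma IsAdapted.flatUnion_subset_closure (hX : IsAdapted S X) :
    flatUnion S ⊆ M.closure (X ∩ flatUnion S) :=
  flatUnion_subset.2 fun K hK ↦ (hX K hK).trans
    (M.closure_subset_closure (inter_subset_inter_right _ (subset_flatUnion hK)))

variable [Finite α]

lemma eq_zero_of_notMem_withMaximal {N : Finset (Flats M)} {a : Flats M → ℝ}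
    (ha : ∀ G ∉ N, ¬ Maximal IsIrred G → a G = 0) :
    ∀ G ∉ withMaximal N, a G = 0 := fun G hG ↦ by
  rw [mem_withMaximal, not_or] at hG
  exact ha G hG.1 hG.2

lemma IsAdapted.ncard_inter_le (hX : M.IsBase X) (hY : M.IsBase Y) (hYa : IsAdapted P Y)
    (hG : G ∈ P) : (X ∩ G.1).ncard ≤ (Y ∩ G.1).ncard :=
  ncard_le_ncard_of_subset_closure (hX.indep.inter_right _) (hY.indep.inter_right _)
    (inter_subset_right.trans (hYa G hG))

lemma IsAdapted.ncard_inter_eq_iff (hX : M.IsBase X) (hY : M.IsBase Y) (hYa : IsAdapted P Y)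
    (hG : G ∈ P) : (X ∩ G.1).ncard = (Y ∩ G.1).ncard ↔ G.1 ⊆ M.closure (X ∩ G.1) := by
  refine ⟨fun h ↦ ?_, fun h ↦ le_antisymm (hYa.ncard_inter_le hX hY hG)
    (ncard_le_ncard_of_subset_closure (hY.indep.inter_right _) (hX.indep.inter_right _)
      (inter_subset_right.trans h))⟩
  have hYX : Y ∩ G.1 ⊆ M.closure (X ∩ G.1) := subset_closure_of_ncard_le_ncard
    (hX.indep.inter_right _) (hY.indep.inter_right _) (inter_subset_right.trans (hYa G hG)) h.ge
  exact (hYa G hG).trans (M.closure_subset_closure_of_subset_closure hYX)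

variable [M.Loopless]

lemma subset_closure_inter_of_maximal (hX : M.IsBase X) (hG : Maximal IsIrred G) :
    G.1 ⊆ M.closure (X ∩ G.1) := fun e he ↦ by
  have hskew := (maximal_isIrred_iff_isComponent.1 hG).skew_sdiff
  refine hskew.mem_closure_left he inter_subset_right
    (sdiff_subset_sdiff_left (t := G.1) hX.subset_ground) ?_
  rw [inter_union_sdiff, hX.closure_eq]
  exact G.2.subset_ground he

lemma IsNested.isFlat_flatUnion (hS : IsNested S) : M.IsFlat (flatUnion S) := by
  refine isFlat_of_closure_subset (flatUnion_subset_ground S) fun x hx ↦ ?_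
  obtain ⟨H, hH, hxH⟩ := hS.exists_subset_of_subset_closure (isConnectedSet_singleton M x)
    (singleton_subset_iff.2 hx)
  exact subset_flatUnion hH (hxH rfl)

lemma IsNested.mem_sdiff_flatUnion_lt_iff [DecidablePred (· < G)] (hP : IsNested P) (hG : G ∈ P) :
    x ∈ G.1 \ flatUnion (P.filter (· < G)) ↔ ∀ K ∈ P, x ∈ K.1 ↔ G ≤ K := by
  refine ⟨fun ⟨hxG, hxF⟩ ↦ ?_, fun hx ↦ ⟨(hx G hG).2 le_rfl, fun hxF ↦ ?_⟩⟩
  · obtain ⟨H, hH, hHx⟩ := hP.exists_forall_mem_iff_le (mem_flatUnion.2 ⟨G, hG, hxG⟩)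
    obtain rfl | hlt := ((hHx G hG).1 hxG).eq_or_lt
    · exact hHx
    · exact absurd (mem_flatUnion.2 ⟨H, Finset.mem_filter.2 ⟨hH, hlt⟩, (hHx H hH).2 le_rfl⟩) hxF
  · obtain ⟨K, hK, hxK⟩ := mem_flatUnion.1 hxF
    obtain ⟨hKP, hKG⟩ := Finset.mem_filter.1 hK
    exact hKG.not_ge ((hx K hKP).1 hxK)

end AdaptedBase

section Cone

variable {α : Type*} [Fintype α] {M : Matroid α} {N : Finset (Flats M)}
  {a b : Flats M → ℝ} {ω ν : α → ℝ} {X Y : Set α} {e f : α}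

/-- `ω = -∑ a_G 1_G` with positive coefficients on `N`, and arbitrary ones on the connected
components; the points of `nestedCell M N` are the cone vectors on the weight sphere. -/
structure IsConeVector (N : Finset (Flats M)) (a : Flats M → ℝ) (ω : α → ℝ) : Prop where
  pos : ∀ G ∈ N, 0 < a G
  eq_zero : ∀ G ∉ N, ¬ Maximal IsIrred G → a G = 0
  eq : ω = -flatComb a

lemma mem_nestedCell : ω ∈ nestedCell M N ↔ ω ∈ weightSphere α ∧ ∃ a, IsConeVector N a ω := by
  refine and_congr_right fun _ ↦ exists_congr fun a ↦
    ⟨fun ⟨h₁, h₂, h₃⟩ ↦ ⟨h₁, h₂, funext fun e ↦ ?_⟩, fun h ↦ ⟨h.pos, h.eq_zero, fun e ↦ ?_⟩⟩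
  · rw [h₃, Pi.neg_apply, flatComb_apply]
  · rw [h.eq, Pi.neg_apply, flatComb_apply]

lemma IsConeVector.eq_zero_of_notMem (ha : IsConeVector N a ω) : ∀ G ∉ withMaximal N, a G = 0 :=
  eq_zero_of_notMem_withMaximal ha.eq_zero

lemma isConeVector_filter_pos [DecidablePred (0 < a ·)] (h0 : ∀ G ∈ N, 0 ≤ a G)
    (ha : ∀ G ∉ N, ¬ Maximal IsIrred G → a G = 0) :
    IsConeVector (N.filter (0 < a ·)) a (-flatComb a) where
  pos G hG := (Finset.mem_filter.1 hG).2
  eq_zero G hG hGm := by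
    by_cases hGN : G ∈ N
    · exact (h0 G hGN).antisymm' (not_lt.1 fun hpos ↦ hG (Finset.mem_filter.2 ⟨hGN, hpos⟩))
    · exact ha G hGN hGm
  eq := rfl

lemma IsConeVector.weight_sub_weight (ha : IsConeVector N a ω) (X Y : Set α) :
    weight ω X - weight ω Y = ∑ G, a G * ((Y ∩ G.1).ncard - (X ∩ G.1).ncard) := by
  simp only [ha.eq, weight_neg_flatComb, mul_sub, Finset.sum_sub_distrib]
  ring

variable [M.Loopless]

lemma IsConeVector.mul_nonneg_of_isAdapted (ha : IsConeVector N a ω) (hX : M.IsBase X)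
    (hY : M.IsBase Y) (hYa : IsAdapted (withMaximal N) Y) (G : Flats M) :
    0 ≤ a G * ((Y ∩ G.1).ncard - (X ∩ G.1).ncard : ℝ) := by
  by_cases hGm : Maximal IsIrred G
  · rw [(hYa.ncard_inter_eq_iff hX hY (mem_withMaximal.2 (.inr hGm))).2
      (subset_closure_inter_of_maximal hX hGm), sub_self, mul_zero]
  by_cases hGN : G ∈ N
  · exact mul_nonneg (ha.pos G hGN).le (sub_nonneg.2 (Nat.cast_le.2
      (hYa.ncard_inter_le hX hY (mem_withMaximal.2 (.inl hGN)))))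
  · rw [ha.eq_zero G hGN hGm, zero_mul]

lemma IsConeVector.weight_le_weight_iff (ha : IsConeVector N a ω) (hX : M.IsBase X)
    (hY : M.IsBase Y) (hYa : IsAdapted (withMaximal N) Y) :
    weight ω X ≤ weight ω Y ↔ IsAdapted (withMaximal N) X := by
  have hnn := ha.mul_nonneg_of_isAdapted hX hY hYa
  rw [← sub_nonpos, ha.weight_sub_weight X Y, (Finset.sum_nonneg fun G _ ↦ hnn G).ge_iff_eq',
    Finset.sum_eq_zero_iff_of_nonneg fun G _ ↦ hnn G]
  refine ⟨fun h0 G hG ↦ ?_, fun hXa G _ ↦ ?_⟩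
  · by_cases hGm : Maximal IsIrred G
    · exact subset_closure_inter_of_maximal hX hGm
    have haG := (ha.pos G ((mem_withMaximal.1 hG).resolve_right hGm)).ne'
    have hcard := (mul_eq_zero.1 (h0 G (Finset.mem_univ G))).resolve_left haG
    exact (hYa.ncard_inter_eq_iff hX hY hG).1 (Nat.cast_injective (sub_eq_zero.1 hcard).symm)
  · by_cases hG : G ∈ withMaximal N
    · rw [(hYa.ncard_inter_eq_iff hX hY hG).2 (hXa G hG), sub_self, mul_zero]
    · rw [ha.eq_zero_of_notMem G hG, zero_mul]

lemma IsConeVector.isMinBase_iff (ha : IsConeVector N a ω) (hN : IsNested N) :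
    IsMinBase M ω X ↔ M.IsBase X ∧ IsAdapted (withMaximal N) X := by
  refine and_congr_right fun hX ↦ ⟨fun h ↦ ?_, fun hXa Z hZ ↦ ?_⟩
  · obtain ⟨Y, hY, hYa⟩ := hN.withMaximal.exists_isBase_isAdapted
    exact (ha.weight_le_weight_iff hX hY hYa).1 (h Y hY)
  · rw [← sub_nonneg, ha.weight_sub_weight]
    exact Finset.sum_nonneg fun G _ ↦ ha.mul_nonneg_of_isAdapted hZ hX hXa G

lemma IsConeVector.loopless (ha : IsConeVector N a ω) (hN : IsNested N) :
    (initialMatroid M ω).Loopless := by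
  refine initialMatroid_loopless_iff.2 fun e he ↦ ?_
  obtain ⟨X, hX, heX, hXa⟩ := hN.withMaximal.exists_isBase_isAdapted_mem
    (e := e) (flatUnion_withMaximal N ▸ he)
  exact ⟨X, (ha.isMinBase_iff hN).2 ⟨hX, hXa⟩, heX⟩

lemma IsConeVector.initialMatroid_eq (ha : IsConeVector N a ω) (hb : IsConeVector N b ν)
    (hN : IsNested N) : initialMatroid M ω = initialMatroid M ν :=
  initialMatroid_eq_iff.2 fun _ ↦ (ha.isMinBase_iff hN).trans (hb.isMinBase_iff hN).symm

lemma IsConeVector.apply_eq_of_isMinBase_iff (ha : IsConeVector N a ω) (hN : IsNested N)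
    (hc : HasConnectedContractions M) (hων : ∀ X, IsMinBase M ω X ↔ IsMinBase M ν X)
    (he : e ∈ M.E) (hef : ∀ K ∈ withMaximal N, e ∈ K.1 ↔ f ∈ K.1) : ν e = ν f := by
  classical
  set P := withMaximal N
  have hP : IsNested P := hN.withMaximal
  obtain ⟨G, hG, hGe⟩ := hP.exists_forall_mem_iff_le (flatUnion_withMaximal N ▸ he)
  obtain ⟨X, hX, hXa⟩ := hP.exists_isBase_isAdapted
  have hSP : P.filter (· < G) ⊆ P := Finset.filter_subset _ _
  have hstratum (x : α) := hP.mem_sdiff_flatUnion_lt_iff (x := x) hG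
  set F := flatUnion (P.filter (· < G))
  have heF : e ∈ G.1 \ F := (hstratum e).2 hGe
  have hfF : f ∈ G.1 \ F := (hstratum f).2 fun K hK ↦ (hef K hK).symm.trans (hGe K hK)
  have hFG : F ⊂ G.1 := (flatUnion_subset.2 fun K hK ↦ (Finset.mem_filter.1 hK).2.le).ssubset_of_ne
    fun h ↦ heF.2 (h.symm.subset heF.1)
  refine eq_of_isConnectedSet_contract
    (hc (hP.mono hSP).isFlat_flatUnion G.2 hFG (hP.1 G hG).isConnectedSet) hX
    (IsAdapted.flatUnion_subset_closure fun K hK ↦ hXa K (hSP hK)) (hXa G hG)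
    (fun x hx y hy hxX hyX hbase ↦ ?_) heF hfF
  refine ((ha.isMinBase_iff hN).2 ⟨hX, hXa⟩).eq_of_exchange hων hxX hyX hbase ?_
  rw [ha.eq, Pi.neg_apply, Pi.neg_apply, flatComb_congr ha.eq_zero_of_notMem fun K hK ↦
    ((hstratum x).1 hx K hK).trans ((hstratum y).1 hy K hK).symm]

lemma IsConeVector.exists_flatComb_of_isMinBase_iff (ha : IsConeVector N a ω) (hE : M.E = univ)
    (hc : HasConnectedContractions M) (hN : IsNested N)
    (hων : ∀ X, IsMinBase M ω X ↔ IsMinBase M ν X) :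
    ∃ b : Flats M → ℝ, (∀ G ∉ withMaximal N, b G = 0) ∧ ν = -flatComb b := by
  obtain ⟨b, hb, hνb⟩ := hN.withMaximal.exists_flatComb_eq (ν := ν)
    ((flatUnion_withMaximal N).trans hE) fun e f hef ↦
      ha.apply_eq_of_isMinBase_iff hN hc hων (hE ▸ mem_univ e) hef
  exact ⟨-b, fun G hG ↦ neg_eq_zero.2 (hb G hG), by rw [map_neg, neg_neg, hνb]⟩

lemma exists_smul_add_smul_eq_zero {ι : Type*} {s : Finset ι} {a b : ι → ℝ}
    (ha : ∀ i ∈ s, 0 < a i) (hb : ∃ i ∈ s, b i ≤ 0) :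
    ∃ r t : ℝ, 0 ≤ r ∧ 0 < t ∧ (∀ i ∈ s, 0 ≤ r * a i + t * b i) ∧
      ∃ i ∈ s, r * a i + t * b i = 0 := by
  obtain ⟨i, hi, hbi⟩ := hb
  obtain ⟨j, hj, hmin⟩ := s.exists_min_image (fun i ↦ b i / a i) ⟨i, hi⟩
  have hbj : b j / a j ≤ 0 := (hmin i hi).trans (div_nonpos_of_nonpos_of_nonneg hbi (ha i hi).le)
  refine ⟨-(b j / a j), 1, neg_nonneg.2 hbj, one_pos, fun k hk ↦ ?_, j, hj, ?_⟩
  · linarith [(le_div_iff₀ (ha k hk)).1 (hmin k hk)]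
  · rw [neg_mul, div_mul_cancel₀ _ (ha j hj).ne']
    ring

/-- If some coefficient of `ν` on `N` were nonpositive, the segment from `ω` to `ν` would meet the
cone of a proper subset of `N`, on which the bases of minimum weight are the same. -/
lemma IsConeVector.exists_isConeVector_of_isMinBase_iff (ha : IsConeVector N a ω)
    (hE : M.E = univ) (hc : HasConnectedContractions M) (hN : IsReducedNested N)
    (hων : ∀ X, IsMinBase M ω X ↔ IsMinBase M ν X) : ∃ b, IsConeVector N b ν := by
  classical
  obtain ⟨b, hb, hνb⟩ := ha.exists_flatComb_of_isMinBase_iff hE hc hN.1 hων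
  have hb' : ∀ G ∉ N, ¬ Maximal IsIrred G → b G = 0 := fun G hG hGm ↦
    hb G (by simp [mem_withMaximal, hG, hGm])
  refine ⟨b, ?_, hb', hνb⟩
  by_contra! hneg
  obtain ⟨r, t, hr, ht, hnn, G, hG, hG0⟩ := exists_smul_add_smul_eq_zero ha.pos hneg
  have hcomb : r • ω + t • ν = -flatComb (r • a + t • b) := by
    rw [ha.eq, hνb, map_add, map_smul, map_smul]
    module
  have hcone := isConeVector_filter_pos (N := N) (a := r • a + t • b) hnn
    fun K hK hKm ↦ by simp [ha.eq_zero K hK hKm, hb' K hK hKm]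
  rw [← hcomb] at hcone
  obtain ⟨d, hd, hωd⟩ := hcone.exists_flatComb_of_isMinBase_iff hE hc
    (hN.1.mono (Finset.filter_subset _ N))
    fun X ↦ (isMinBase_smul_add_smul_iff hων hr ht).trans (hων X).symm
  have hdG : d G = 0 := hd G fun hG' ↦ (mem_withMaximal.1 hG').elim
    (fun h ↦ (Finset.mem_filter.1 h).2.ne' hG0) (hN.2 G hG)
  have had : a = d := hN.1.withMaximal.eq_of_flatComb_eq ha.eq_zero_of_notMem
    (fun K hK ↦ hd K (mt (fun h ↦ mem_withMaximal.2
      ((mem_withMaximal.1 h).imp_left fun h ↦ Finset.filter_subset _ N h)) hK))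
    (neg_injective (ha.eq.symm.trans hωd))
  exact (ha.pos G hG).ne' (had ▸ hdG)

end Cone

section SublevelComponent

variable {α : Type*} [Finite α] {M : Matroid α} [M.Loopless] {N : Finset (Flats M)} {ω : α → ℝ}

lemma isReducedNested_of_forall_isComponent (hL : ∀ t, M.IsFlat {x | ω x ≤ t})
    (hN : ∀ G ∈ N, ¬ Maximal IsIrred G ∧ ∃ t, IsComponent M {x | ω x ≤ t} G.1) :
    IsReducedNested N := by
  refine ⟨⟨fun G hG ↦ ?_, fun A hA hcard hanti ↦ ?_⟩, fun G hG ↦ (hN G hG).1⟩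
  · obtain ⟨-, t, ht⟩ := hN G hG
    exact ht.isConnectedSet.isIrred
  · have hτ : ∀ G : Flats M, ∃ t, G ∈ A → IsComponent M {x | ω x ≤ t} G.1 := fun G ↦
      (em (G ∈ A)).elim (fun hG ↦ (hN G (hA hG)).2.imp fun _ h _ ↦ h) fun hG ↦
        ⟨0, fun h ↦ (hG h).elim⟩
    choose τ hτ using hτ
    obtain ⟨C, hC, hmax⟩ := A.exists_max_image τ (Finset.card_pos.1 (by omega))
    refine ⟨_, isLUB_flatClosure_flatUnion A,
      not_isIrred_flatClosure_flatUnion hcard hanti hC (hτ C hC) ?_⟩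
    refine closure_subset_of_isFlat (hL _) (flatUnion_subset.2 fun G hG x hx ↦ ?_)
    exact ((hτ G hG).subset hx).trans (hmax G hG)

end SublevelComponent

section Component

variable {α : Type*} [Fintype α] {M : Matroid α} {F : Set α} {C : Flats M}
  {a : Flats M → ℝ} {e : α}

lemma flatComb_apply_of_mem_isComponent (ha : ∀ G : Flats M, ¬ IsComponent M F G.1 → a G = 0)
    (hC : IsComponent M F C.1) (he : e ∈ C.1) : flatComb a e = a C := by
  rw [flatComb_apply, Finset.sum_eq_single C (fun G _ hGC ↦ ?_) (by simp), indicator_of_mem he]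
  by_cases hG : IsComponent M F G.1
  · refine indicator_of_notMem (fun heG ↦ hGC (Subtype.ext ?_)) _
    exact (hC.subset_of_mem hG.isConnectedSet hG.subset he heG).antisymm
      (hG.subset_of_mem hC.isConnectedSet hC.subset heG he)
  · rw [ha G hG, indicator_zero]

variable [M.Loopless]

lemma flatComb_apply_of_mem_maximal (ha : ∀ G : Flats M, ¬ Maximal IsIrred G → a G = 0)
    (hC : Maximal IsIrred C) (he : e ∈ C.1) : flatComb a e = a C :=
  flatComb_apply_of_mem_isComponent (fun G hG ↦ ha G (mt maximal_isIrred_iff_isComponent.1 hG))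
    (maximal_isIrred_iff_isComponent.1 hC) he

open Classical in
lemma flatComb_ite_isComponent (hF : M.IsFlat F) (c : ℝ) :
    flatComb (fun G : Flats M ↦ if IsComponent M F G.1 then c else 0) =
      F.indicator fun _ ↦ c := by
  ext e
  by_cases he : e ∈ F
  · obtain ⟨C, hC, heC⟩ := exists_isComponent_mem M he
    let C' : Flats M := ⟨C, hC.closure_eq hF ▸ M.isFlat_closure C⟩
    rw [flatComb_apply_of_mem_isComponent (C := C') (fun G hG ↦ if_neg hG) hC heC, if_pos hC,
      indicator_of_mem he]
  · rw [indicator_of_notMem he, flatComb_apply]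
    refine Finset.sum_eq_zero fun G _ ↦ ?_
    by_cases hG : IsComponent M F G.1
    · exact indicator_of_notMem (fun heG ↦ he (hG.subset heG)) _
    · rw [if_neg hG, indicator_zero]

open Classical in
lemma flatComb_ite_maximal (hE : M.E = univ) (c : ℝ) :
    flatComb (fun G : Flats M ↦ if Maximal IsIrred G then c else 0) = fun _ ↦ c := by
  simp only [maximal_isIrred_iff_isComponent]
  rw [flatComb_ite_isComponent M.ground_isFlat, hE, indicator_univ]

end Component

section Sublevel

lemma exists_pos_eq_sub_sum (T : Finset ℝ) (m : ℝ) (hm : ∀ t ∈ T, t < m) :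
    ∃ δ : ℝ → ℝ, (∀ t ∈ T, 0 < δ t) ∧ ∀ x ∈ T, x = m - ∑ t ∈ T with x ≤ t, δ t := by
  induction T using Finset.induction_on_max generalizing m with
  | empty => exact ⟨0, by simp, by simp⟩
  | insert a T hT ih =>
    have haT : a ∉ T := fun h ↦ lt_irrefl a (hT a h)
    obtain ⟨δ, hδ, hδT⟩ := ih a hT
    have hne : ∀ t ∈ T, t ≠ a := fun t ht h ↦ haT (h ▸ ht)
    refine ⟨Function.update δ a (m - a), fun t ht ↦ ?_, fun x hx ↦ ?_⟩
    · obtain rfl | ht := Finset.mem_insert.1 ht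
      · simpa using hm t (Finset.mem_insert_self _ _)
      · simpa [hne t ht] using hδ t ht
    · have hsum : ∑ t ∈ T with x ≤ t, Function.update δ a (m - a) t = ∑ t ∈ T with x ≤ t, δ t :=
        Finset.sum_congr rfl fun t ht ↦ by simp [hne t (Finset.mem_filter.1 ht).1]
      have hxa : x ≤ a := (Finset.mem_insert.1 hx).elim Eq.le fun h ↦ (hT x h).le
      rw [Finset.filter_insert, if_pos hxa, Finset.sum_insert (by simp [haT]), hsum,
        Function.update_self]
      obtain rfl | hx := Finset.mem_insert.1 hx
      · rw [Finset.filter_eq_empty_iff.2 fun t ht ↦ (hT t ht).not_ge, Finset.sum_empty]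
        ring
      · linarith [hδT x hx]

variable {α : Type*} [Fintype α] {M : Matroid α} {N : Finset (Flats M)} {G H : Flats M}
  {a : Flats M → ℝ} {ω : α → ℝ} {e f : α}

lemma IsConeVector.pos_of_lt (ha : IsConeVector N a ω) (hG : G ∈ withMaximal N)
    (hH : IsIrred H) (hGH : G < H) : 0 < a G :=
  (mem_withMaximal.1 hG).elim (ha.pos G) fun hGm ↦ absurd (hGm.eq_of_le hH hGH.le) hGH.ne

lemma isFlat_sublevel (hE : M.E = univ) (hω : (initialMatroid M ω).Loopless) (t : ℝ) :
    M.IsFlat {x | ω x ≤ t} := by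
  refine isFlat_of_closure_subset (hE ▸ subset_univ _) fun e he ↦ by_contra fun het ↦ ?_
  obtain ⟨X, hX, heX⟩ := initialMatroid_loopless_iff.1 hω e (hE ▸ mem_univ e)
  obtain ⟨f, hf, hfX⟩ : ∃ f, ω f ≤ t ∧ f ∉ M.closure (X \ {e}) := by
    by_contra! hcon
    exact hX.1.indep.notMem_closure_sdiff_of_mem heX
      (M.closure_subset_closure_of_subset_closure hcon he)
  have hlt : ω f < ω e := hf.trans_lt (not_le.1 het)
  have hfX' : f ∉ X := fun h ↦ hfX (M.subset_closure (X \ {e})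
    (sdiff_subset.trans hX.1.subset_ground) ⟨h, fun hfe ↦ hlt.ne (congrArg ω hfe)⟩)
  have hle := hX.2 _ (hX.1.exchange_base_of_notMem_closure heX hfX (hE ▸ mem_univ f))
  rw [weight_exchange ω heX hfX'] at hle
  linarith

variable [M.Loopless]

/-- Writing the values of `ω` as `m - ∑ δ_t` with positive jumps `δ_t` expresses `ω` as a
combination of indicator vectors of sublevel sets, which split into their components. -/
lemma exists_isConeVector_of_loopless (hE : M.E = univ) (hω : (initialMatroid M ω).Loopless) :
    ∃ N a, IsReducedNested N ∧ IsConeVector (M := M) N a ω := by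
  classical
  have hL := isFlat_sublevel hE hω
  let T : Finset ℝ := Finset.univ.image ω
  obtain ⟨m, hm⟩ := T.bddAbove
  obtain ⟨δ, hδ, hδω⟩ := exists_pos_eq_sub_sum T (m + 1)
    fun t ht ↦ (hm ht).trans_lt (lt_add_one m)
  let jump (t : ℝ) (G : Flats M) : ℝ := if IsComponent M {x | ω x ≤ t} G.1 then δ t else 0
  let top (G : Flats M) : ℝ := if Maximal IsIrred G then m + 1 else 0
  let N : Finset (Flats M) := {G | ¬ Maximal IsIrred G ∧ ∃ t ∈ T, IsComponent M {x | ω x ≤ t} G.1}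
  have happly {G : Flats M} (hG : ¬ Maximal IsIrred G) :
      (∑ t ∈ T, jump t - top) G = ∑ t ∈ T, jump t G := by simp [top, hG]
  refine ⟨N, ∑ t ∈ T, jump t - top, isReducedNested_of_forall_isComponent hL fun G hG ↦ ?_,
    fun G hG ↦ ?_, fun G hG hGm ↦ ?_, funext fun e ↦ ?_⟩
  · obtain ⟨hGm, t, -, ht⟩ := (Finset.mem_filter.1 hG).2
    exact ⟨hGm, t, ht⟩
  · obtain ⟨hGm, t, htT, ht⟩ := (Finset.mem_filter.1 hG).2
    rw [happly hGm]
    refine Finset.sum_pos' (fun s hs ↦ ?_) ⟨t, htT, (hδ t htT).trans_eq (if_pos ht).symm⟩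
    exact ite_nonneg (hδ s hs).le le_rfl
  · rw [happly hGm]
    exact Finset.sum_eq_zero fun t ht ↦ if_neg fun hc ↦
      hG (Finset.mem_filter.2 ⟨Finset.mem_univ G, hGm, t, ht, hc⟩)
  · have hωe := hδω (ω e) (Finset.mem_image_of_mem ω (Finset.mem_univ e))
    rw [Finset.sum_filter] at hωe
    simp only [map_sub, map_sum, jump, top, flatComb_ite_isComponent (hL _),
      flatComb_ite_maximal hE, Pi.neg_apply, Pi.sub_apply, Finset.sum_apply, indicator_apply,
      mem_ofPred_eq]
    linarith

lemma IsConeVector.apply_lt_apply (ha : IsConeVector N a ω) (hN : IsNested N)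
    (hG : G ∈ withMaximal N) (hH : H ∈ withMaximal N) (hGH : G < H)
    (he : ∀ K ∈ withMaximal N, e ∈ K.1 ↔ G ≤ K) (hf : ∀ K ∈ withMaximal N, f ∈ K.1 ↔ H ≤ K) :
    ω e < ω f := by
  classical
  have hP := hN.withMaximal
  rw [ha.eq, Pi.neg_apply, Pi.neg_apply, neg_lt_neg_iff, flatComb_eq_sum ha.eq_zero_of_notMem he,
    flatComb_eq_sum ha.eq_zero_of_notMem hf]
  refine Finset.sum_lt_sum_of_subset (i := G) ?_ (Finset.mem_filter.2 ⟨hG, le_rfl⟩)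
    (fun h ↦ hGH.not_ge (Finset.mem_filter.1 h).2) (ha.pos_of_lt hG (hP.1 H hH) hGH)
    fun K hK hK' ↦ ?_
  · exact Finset.monotone_filter_right _ fun K _ ↦ hGH.le.trans
  · obtain ⟨hKP, hGK⟩ := Finset.mem_filter.1 hK
    have hHK : ¬ H ≤ K := fun h ↦ hK' (Finset.mem_filter.2 ⟨hKP, h⟩)
    have hKH : K ≤ H := (hP.le_or_le_of_mem hKP hH ((he K hKP).2 hGK)
      ((he H hH).2 hGH.le)).resolve_right hHK
    exact (ha.pos_of_lt hKP (hP.1 H hH) (hKH.lt_of_not_ge hHK)).le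

lemma IsConeVector.apply_le_apply (ha : IsConeVector N a ω) (hN : IsNested N)
    (hH : H ∈ withMaximal N) (hf : ∀ K ∈ withMaximal N, f ∈ K.1 ↔ H ≤ K) (he : e ∈ H.1) :
    ω e ≤ ω f := by
  obtain ⟨G, hG, hGe⟩ := hN.withMaximal.exists_forall_mem_iff_le (mem_flatUnion.2 ⟨H, hH, he⟩)
  obtain rfl | hlt := ((hGe H hH).1 he).eq_or_lt
  · refine le_of_eq ?_
    rw [ha.eq, Pi.neg_apply, Pi.neg_apply, flatComb_congr ha.eq_zero_of_notMem fun K hK ↦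
      (hGe K hK).trans (hf K hK).symm]
  · exact (ha.apply_lt_apply hN hG hH hlt hGe hf).le

lemma IsConeVector.sublevel_subset_flatUnion (ha : IsConeVector N a ω) (hN : IsNested N)
    (hE : M.E = univ) (t : ℝ) [DecidablePred fun G : Flats M ↦ G.1 ⊆ {x | ω x ≤ t}] :
    {x | ω x ≤ t} ⊆ flatUnion ((withMaximal N).filter fun G ↦ G.1 ⊆ {x | ω x ≤ t}) := by
  intro e he
  obtain ⟨G, hG, hGe⟩ := hN.withMaximal.exists_forall_mem_iff_le (e := e)
    (flatUnion_withMaximal N ▸ hE ▸ mem_univ e)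
  exact mem_flatUnion.2 ⟨G, Finset.mem_filter.2 ⟨hG, fun x hx ↦
    (ha.apply_le_apply hN hG hGe hx).trans he⟩, (hGe G hG).2 le_rfl⟩

lemma IsConeVector.exists_mem_withMaximal_of_subset_sublevel (ha : IsConeVector N a ω)
    (hN : IsNested N) (hE : M.E = univ) {K : Set α} (hK : IsConnectedSet M K) {t : ℝ}
    (hKt : K ⊆ {x | ω x ≤ t}) : ∃ H ∈ withMaximal N, K ⊆ H.1 ∧ H.1 ⊆ {x | ω x ≤ t} := by
  classical
  obtain ⟨H, hH, hKH⟩ := (hN.withMaximal.mono (Finset.filter_subset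
    (fun G : Flats M ↦ G.1 ⊆ {x | ω x ≤ t}) _)).exists_subset_of_subset_closure hK
    ((hKt.trans (ha.sublevel_subset_flatUnion hN hE t)).trans (flatUnion_subset_closure _))
  exact ⟨H, (Finset.mem_filter.1 hH).1, hKH, (Finset.mem_filter.1 hH).2⟩

lemma IsConeVector.mem_iff_isComponent (ha : IsConeVector N a ω) (hN : IsReducedNested N)
    (hE : M.E = univ) :
    G ∈ N ↔ ¬ Maximal IsIrred G ∧ ∃ t, IsComponent M {x | ω x ≤ t} G.1 := by
  have hP := hN.1.withMaximal
  refine ⟨fun hG ↦ ⟨hN.2 G hG, ?_⟩, fun ⟨hGm, t, hGt⟩ ↦ ?_⟩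
  · have hGP : G ∈ withMaximal N := mem_withMaximal.2 (.inl hG)
    obtain ⟨e, he⟩ := hP.exists_generic_element hGP
    refine ⟨ω e, ⟨(hP.1 G hGP).isConnectedSet, fun x hx ↦ ha.apply_le_apply hN.1 hGP he hx⟩,
      fun K hK hGK ↦ ?_⟩
    obtain ⟨H, hH, hKH, hHe⟩ := ha.exists_mem_withMaximal_of_subset_sublevel hN.1 hE hK.1 hK.2
    obtain rfl | hlt := (show G ≤ H from hGK.trans hKH).eq_or_lt
    · exact hKH
    · obtain ⟨f, hf⟩ := hP.exists_generic_element hH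
      exact absurd (hHe ((hf H hH).2 le_rfl)) (ha.apply_lt_apply hN.1 hGP hH hlt he hf).not_ge
  · obtain ⟨H, hH, hGH, hHt⟩ :=
      ha.exists_mem_withMaximal_of_subset_sublevel hN.1 hE hGt.isConnectedSet hGt.subset
    obtain rfl : G = H := Subtype.ext (hGt.eq_of_subset ⟨(hP.1 H hH).isConnectedSet, hHt⟩ hGH)
    exact (mem_withMaximal.1 hH).resolve_right hGm

lemma IsConeVector.unique {N' : Finset (Flats M)} {b : Flats M → ℝ} (ha : IsConeVector N a ω)
    (hb : IsConeVector N' b ω) (hN : IsReducedNested N) (hN' : IsReducedNested N')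
    (hE : M.E = univ) : N = N' ∧ a = b := by
  obtain rfl : N = N' := Finset.ext fun G ↦
    (ha.mem_iff_isComponent hN hE).trans (hb.mem_iff_isComponent hN' hE).symm
  exact ⟨rfl, hN.1.withMaximal.eq_of_flatComb_eq ha.eq_zero_of_notMem hb.eq_zero_of_notMem
    (neg_injective (ha.eq.symm.trans hb.eq))⟩

lemma nestedCell_subset_bergmanComplex (hN : IsNested N) : nestedCell M N ⊆ bergmanComplex M :=
  fun ω hω ↦ by
    obtain ⟨hωs, a, ha⟩ := mem_nestedCell.1 hω
    exact ⟨hωs, ha.loopless hN⟩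

lemma IsConeVector.initialMatroid_fiber_eq (ha : IsConeVector N a ω) (hN : IsReducedNested N)
    (hE : M.E = univ) (hc : HasConnectedContractions M) :
    {ν ∈ bergmanComplex M | initialMatroid M ν = initialMatroid M ω} = nestedCell M N := by
  ext ν
  refine ⟨fun ⟨hν, heq⟩ ↦ mem_nestedCell.2 ⟨hν.1, ha.exists_isConeVector_of_isMinBase_iff hE hc hN
    (initialMatroid_eq_iff.1 heq.symm)⟩, fun hν ↦ ⟨nestedCell_subset_bergmanComplex hN.1 hν, ?_⟩⟩
  obtain ⟨-, b, hb⟩ := mem_nestedCell.1 hν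
  exact hb.initialMatroid_eq ha hN.1

theorem coarseCells_eq (hE : M.E = univ) (hc : HasConnectedContractions M) : coarseCells M =
    {C | C.Nonempty ∧ ∃ N, IsReducedNested N ∧ C = nestedCell M N} := by
  ext C
  constructor
  · rintro ⟨ω, hω, rfl⟩
    obtain ⟨N, a, hN, ha⟩ := exists_isConeVector_of_loopless hE hω.2
    exact ⟨⟨ω, hω, rfl⟩, N, hN, ha.initialMatroid_fiber_eq hN hE hc⟩
  · rintro ⟨⟨ω, hω⟩, N, hN, rfl⟩
    obtain ⟨-, a, ha⟩ := mem_nestedCell.1 hω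
    exact ⟨ω, nestedCell_subset_bergmanComplex hN.1 hω,
      ha.initialMatroid_fiber_eq hN hE hc⟩

end Sublevel

section Normalization

variable {α : Type*} [Fintype α] {ω : α → ℝ}

/-- The multiple of `ω` whose squares have sum `1`, the point in which the ray through `ω` meets
the unit sphere. It is `0` for `ω = 0`. -/
def normalizeWeight (ω : α → ℝ) : α → ℝ := (√(∑ e, ω e ^ 2))⁻¹ • ω

lemma sum_sq_pos (hω : ω ≠ 0) : 0 < ∑ e, ω e ^ 2 := by
  obtain ⟨e, he⟩ := Function.ne_iff.1 hω
  exact Finset.sum_pos' (fun _ _ ↦ sq_nonneg _) ⟨e, Finset.mem_univ e, sq_pos_of_ne_zero he⟩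

lemma inv_sqrt_sum_sq_pos (hω : ω ≠ 0) : 0 < (√(∑ e, ω e ^ 2))⁻¹ :=
  inv_pos.2 (Real.sqrt_pos.2 (sum_sq_pos hω))

lemma normalizeWeight_mem_weightSphere (hω : ω ≠ 0) (h0 : ∑ e, ω e = 0) :
    normalizeWeight ω ∈ weightSphere α := by
  constructor
  · simp only [normalizeWeight, Pi.smul_apply, ← Finset.smul_sum, h0, smul_zero]
  · simp only [normalizeWeight, Pi.smul_apply, smul_eq_mul, mul_pow, ← Finset.mul_sum, inv_pow]
    rw [Real.sq_sqrt (sum_sq_pos hω).le, inv_mul_cancel₀ (sum_sq_pos hω).ne']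

lemma normalizeWeight_smul {c : ℝ} (hc : 0 < c) (ω : α → ℝ) :
    normalizeWeight (c • ω) = normalizeWeight ω := by
  simp only [normalizeWeight, Pi.smul_apply, smul_eq_mul, mul_pow, ← Finset.mul_sum]
  rw [Real.sqrt_mul (sq_nonneg c), Real.sqrt_sq hc.le, smul_smul, mul_inv, mul_right_comm,
    inv_mul_cancel₀ hc.ne', one_mul]

lemma normalizeWeight_eq_self (hω : ω ∈ weightSphere α) : normalizeWeight ω = ω := by
  rw [normalizeWeight, hω.2, Real.sqrt_one, inv_one, one_smul]

lemma continuousAt_normalizeWeight (hω : ω ≠ 0) : ContinuousAt normalizeWeight ω := by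
  have hcont : Continuous fun ω : α → ℝ ↦ √(∑ e, ω e ^ 2) := by fun_prop
  exact (hcont.continuousAt.inv₀ (Real.sqrt_pos.2 (sum_sq_pos hω)).ne').smul continuousAt_id

lemma ne_zero_of_mem_weightSphere (hω : ω ∈ weightSphere α) : ω ≠ 0 := by
  rintro rfl
  simpa using hω.2

end Normalization

section ConeArithmetic

variable {α : Type*} [Fintype α] {M : Matroid α} {N N' : Finset (Flats M)}
  {a b : Flats M → ℝ} {ω ψ : α → ℝ}

lemma IsConeVector.smul (ha : IsConeVector N a ω) {c : ℝ} (hc : 0 < c) :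
    IsConeVector N (c • a) (c • ω) where
  pos G hG := mul_pos hc (ha.pos G hG)
  eq_zero G hG hGm := by rw [Pi.smul_apply, ha.eq_zero G hG hGm, smul_zero]
  eq := by rw [ha.eq, map_smul, smul_neg]

lemma IsConeVector.add (ha : IsConeVector N a ω) (hb : IsConeVector N' b ψ) (hNN' : N ⊆ N')
    (hN' : IsReducedNested N') : IsConeVector N' (a + b) (ω + ψ) where
  pos G hG := by
    have ha0 : 0 ≤ a G := by
      by_cases hGN : G ∈ N
      · exact (ha.pos G hGN).le
      · exact (ha.eq_zero G hGN (hN'.2 G hG)).ge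
    exact add_pos_of_nonneg_of_pos ha0 (hb.pos G hG)
  eq_zero G hG hGm := by
    rw [Pi.add_apply, ha.eq_zero G (notMem_subset hNN' hG) hGm, hb.eq_zero G hG hGm, add_zero]
  eq := by rw [ha.eq, hb.eq, map_add, neg_add]

open Classical in
lemma isConeVector_ite_mem (N : Finset (Flats M)) :
    IsConeVector N (fun G ↦ if G ∈ N then 1 else 0) (-flatComb fun G ↦ if G ∈ N then 1 else 0) where
  pos G hG := by simp only [hG, if_true, zero_lt_one]
  eq_zero G hG _ := if_neg hG
  eq := rfl

lemma IsConeVector.normalizeWeight_mem_nestedCell (ha : IsConeVector N a ω) (hω : ω ≠ 0)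
    (h0 : ∑ e, ω e = 0) : normalizeWeight ω ∈ nestedCell M N :=
  mem_nestedCell.2 ⟨normalizeWeight_mem_weightSphere hω h0, _, ha.smul (inv_sqrt_sum_sq_pos hω)⟩

end ConeArithmetic

lemma IsIrred.ncard_pos {α : Type*} [Finite α] {M : Matroid α} [M.Loopless] {G : Flats M}
    (hG : IsIrred G) : 0 < G.1.ncard :=
  hG.isConnectedSet.nonempty.ncard_pos

section ComponentProj

variable {α : Type*} [Fintype α] {M : Matroid α} {N N' : Finset (Flats M)}
  {a d : Flats M → ℝ} {ω ψ : α → ℝ}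

lemma weight_const (c : ℝ) (X : Set α) : weight (fun _ ↦ c) X = X.ncard * c := by
  classical
  rw [weight, Finset.sum_indicator_eq_sum_filter, Finset.sum_const, nsmul_eq_mul,
    ncard_eq_toFinset_card', filter_mem_univ_eq_toFinset]

lemma weight_congr {X : Set α} (h : ∀ e ∈ X, ω e = ψ e) : weight ω X = weight ψ X :=
  Finset.sum_congr rfl fun e _ ↦ congrFun (indicator_congr h) e

lemma sum_mul_flatComb (ω : α → ℝ) (a : Flats M → ℝ) :
    ∑ e, ω e * flatComb a e = ∑ G, a G * weight ω G.1 := by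
  simp only [flatComb_apply, weight, Finset.mul_sum]
  rw [Finset.sum_comm]
  refine Finset.sum_congr rfl fun G _ ↦ Finset.sum_congr rfl fun e _ ↦ ?_
  by_cases he : e ∈ G.1 <;> simp [he, mul_comm]

open Classical in
/-- The averages of a weight vector over the connected components of `M`, as coefficients of the
indicator vectors of flats. -/
def componentMean (M : Matroid α) : (α → ℝ) →ₗ[ℝ] (Flats M → ℝ) where
  toFun ω G := if Maximal IsIrred G then weight ω G.1 / G.1.ncard else 0
  map_add' ω ψ := by
    ext G
    by_cases hG : Maximal IsIrred G <;> simp [hG, weight_add, add_div]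
  map_smul' c ω := by
    ext G
    by_cases hG : Maximal IsIrred G <;> simp [hG, weight_smul, mul_div_assoc]

lemma componentMean_of_maximal {C : Flats M} (hC : Maximal IsIrred C) (ω : α → ℝ) :
    componentMean M ω C = weight ω C.1 / C.1.ncard :=
  if_pos hC

lemma componentMean_of_not_maximal {G : Flats M} (hG : ¬ Maximal IsIrred G) (ω : α → ℝ) :
    componentMean M ω G = 0 :=
  if_neg hG

/-- The projection onto the weight vectors with sum zero on every connected component of `M`, along
the combinations of the indicator vectors of the components. -/
def componentProj (M : Matroid α) : (α → ℝ) →ₗ[ℝ] (α → ℝ) :=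
  LinearMap.id - flatComb ∘ₗ componentMean M

lemma componentProj_apply (ω : α → ℝ) :
    componentProj M ω = ω - flatComb (componentMean M ω) :=
  rfl

lemma componentProj_eq_self (hω : ω ∈ componentSumZero M) : componentProj M ω = ω := by
  have hmean : componentMean M ω = 0 := by
    ext G
    by_cases hG : Maximal IsIrred G
    · rw [componentMean_of_maximal hG, hω G hG, zero_div, Pi.zero_apply]
    · rw [componentMean_of_not_maximal hG, Pi.zero_apply]
  rw [componentProj_apply, hmean, map_zero, sub_zero]

lemma smul_mem_componentSumZero (hω : ω ∈ componentSumZero M) (c : ℝ) :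
    c • ω ∈ componentSumZero M := fun C hC ↦ by rw [weight_smul, hω C hC, mul_zero]

lemma IsConeVector.componentProj (ha : IsConeVector N a ω) (hN : IsReducedNested N) :
    IsConeVector N (a + componentMean M ω) (componentProj M ω) where
  pos G hG := by
    rw [Pi.add_apply, componentMean_of_not_maximal (hN.2 G hG), add_zero]
    exact ha.pos G hG
  eq_zero G hG hGm := by
    rw [Pi.add_apply, componentMean_of_not_maximal hGm, ha.eq_zero G hG hGm, add_zero]
  eq := by rw [componentProj_apply, map_add, neg_add, ← ha.eq, sub_eq_add_neg]

variable [M.Loopless]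

lemma componentMean_flatComb (hd : ∀ G, ¬ Maximal IsIrred G → d G = 0) :
    componentMean M (flatComb d) = d := by
  ext C
  by_cases hC : Maximal IsIrred C
  · rw [componentMean_of_maximal hC,
      weight_congr fun e he ↦ flatComb_apply_of_mem_maximal hd hC he, weight_const,
      mul_div_cancel_left₀ _ (Nat.cast_ne_zero.2 hC.prop.ncard_pos.ne')]
  · rw [componentMean_of_not_maximal hC, hd C hC]

lemma componentProj_flatComb (hd : ∀ G, ¬ Maximal IsIrred G → d G = 0) :
    componentProj M (flatComb d) = 0 := by
  rw [componentProj_apply, componentMean_flatComb hd, sub_self]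

lemma componentProj_mem_componentSumZero (ω : α → ℝ) :
    componentProj M ω ∈ componentSumZero M := by
  intro C hC
  have heq : ∀ e ∈ C.1, componentProj M ω e =
      (ω + fun _ ↦ -componentMean M ω C : α → ℝ) e := fun e he ↦ by
    rw [componentProj_apply, Pi.sub_apply, Pi.add_apply, sub_eq_add_neg,
      flatComb_apply_of_mem_maximal (fun G hG ↦ componentMean_of_not_maximal hG ω) hC he]
  rw [weight_congr heq, weight_add, weight_const, componentMean_of_maximal hC, mul_neg,
    mul_div_cancel₀ _ (Nat.cast_ne_zero.2 hC.prop.ncard_pos.ne'), add_neg_cancel]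

lemma sum_eq_zero_of_mem_componentSumZero (hω : ω ∈ componentSumZero M) (hE : M.E = univ) :
    ∑ e, ω e = 0 := by
  classical
  have hsum := sum_mul_flatComb ω fun G : Flats M ↦ if Maximal IsIrred G then (1 : ℝ) else 0
  simp only [flatComb_ite_maximal hE, mul_one] at hsum
  refine hsum.trans (Finset.sum_eq_zero fun G _ ↦ ?_)
  by_cases hG : Maximal IsIrred G
  · rw [hω G hG, mul_zero]
  · rw [if_neg hG, zero_mul]

lemma weightSphere_subset_componentSumZero (hE : M.E = univ) (hM : IsConnectedSet M univ) :
    weightSphere α ⊆ componentSumZero M := by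
  intro ω hω C hC
  have hskew := (maximal_isIrred_iff_isComponent.1 hC).skew_sdiff
  have hunion : C.1 ∪ M.E \ C.1 = univ := by
    rw [union_sdiff_cancel C.2.subset_ground, hE]
  have hCu : C.1 = univ := by
    rw [← hunion, (hM.eq_empty_or_eq_empty hunion hskew).resolve_left
      hC.prop.isConnectedSet.nonempty.ne_empty, union_empty]
  rw [hCu, weight, indicator_univ, hω.1]

end ComponentProj

section Closure

variable {α : Type*} [Fintype α] {M : Matroid α} [M.Loopless] {N N' : Finset (Flats M)}
  {a : Flats M → ℝ} {ω : α → ℝ}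

open Filter Topology

lemma nestedCell_subset_closure (hN' : IsReducedNested N') (hNN' : N ⊆ N') (hE : M.E = univ) :
    nestedCell M N ⊆ closure (nestedCell M N') := by
  classical
  intro ω hω
  obtain ⟨hωs, a, ha⟩ := mem_nestedCell.1 hω
  obtain ⟨b, ψ, hb, hψ0⟩ : ∃ b ψ, IsConeVector N' b ψ ∧ ∑ e, ψ e = 0 :=
    ⟨_, _, (isConeVector_ite_mem N').componentProj hN',
      sum_eq_zero_of_mem_componentSumZero (componentProj_mem_componentSumZero _) hE⟩
  have hω0 := ne_zero_of_mem_weightSphere hωs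
  have hlim : Tendsto (fun ε : ℝ ↦ ω + ε • ψ) (𝓝[>] 0) (𝓝 ω) := by
    have hcont : Continuous fun ε : ℝ ↦ ω + ε • ψ := by fun_prop
    simpa only [zero_smul, add_zero] using (hcont.tendsto 0).mono_left nhdsWithin_le_nhds
  have hlim' : Tendsto (fun ε : ℝ ↦ normalizeWeight (ω + ε • ψ)) (𝓝[>] 0) (𝓝 ω) := by
    simpa only [normalizeWeight_eq_self hωs, Function.comp_def] using
      (continuousAt_normalizeWeight hω0).tendsto.comp hlim
  refine mem_closure_of_tendsto hlim' ?_
  filter_upwards [self_mem_nhdsWithin, hlim.eventually_ne hω0] with ε hε hne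
  refine (ha.add (hb.smul hε) hNN' hN').normalizeWeight_mem_nestedCell hne ?_
  simp only [Pi.add_apply, Pi.smul_apply, Finset.sum_add_distrib, ← Finset.smul_sum, hωs.1, hψ0,
    smul_zero, add_zero]

lemma isClosed_nonneg_cone (hN : IsNested N) :
    IsClosed {ω | ∃ a : Flats M → ℝ, (∀ G ∈ N, 0 ≤ a G) ∧
      (∀ G ∉ N, ¬ Maximal IsIrred G → a G = 0) ∧ ω = -flatComb a} := by
  let S : Submodule ℝ (Flats M → ℝ) := Submodule.pi (↑(withMaximal N))ᶜ fun _ ↦ ⊥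
  have hS (c : S) : ∀ G ∉ withMaximal N, c.1 G = 0 := c.2
  let T : S →ₗ[ℝ] (α → ℝ) := -flatComb ∘ₗ S.subtype
  have hT : Function.Injective T := fun c d hcd ↦ Subtype.ext <|
    hN.withMaximal.eq_of_flatComb_eq (hS c) (hS d) (neg_injective hcd)
  have hQ : IsClosed {c : S | ∀ G ∈ N, 0 ≤ c.1 G} := by
    simp only [ofPred_forall]
    exact isClosed_biInter fun G _ ↦
      isClosed_le continuous_const ((continuous_apply G).comp continuous_subtype_val)
  convert (LinearMap.isClosedEmbedding_of_injective (LinearMap.ker_eq_bot.2 hT)).isClosedMap _ hQ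
    using 1
  ext ω
  constructor
  · rintro ⟨a, h0, ha, rfl⟩
    exact ⟨⟨a, eq_zero_of_notMem_withMaximal ha⟩, h0, rfl⟩
  · rintro ⟨c, h0, rfl⟩
    exact ⟨c, h0, fun G hG hGm ↦ hS c G fun h ↦ (mem_withMaximal.1 h).elim hG hGm, rfl⟩

lemma IsConeVector.subset_of_mem_closure (ha : IsConeVector N a ω) (hN : IsReducedNested N)
    (hN' : IsReducedNested N') (hE : M.E = univ) (hω : ω ∈ closure (nestedCell M N')) :
    N ⊆ N' := by
  classical
  obtain ⟨b, hb0, hb, rfl⟩ := closure_minimal (fun ν hν ↦ by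
    obtain ⟨-, b, hb⟩ := mem_nestedCell.1 hν
    exact ⟨b, fun G hG ↦ (hb.pos G hG).le, hb.eq_zero, hb.eq⟩) (isClosed_nonneg_cone hN'.1) hω
  have hsub : N'.filter (0 < b ·) ⊆ N' := Finset.filter_subset _ _
  obtain ⟨rfl, -⟩ := ha.unique (isConeVector_filter_pos hb0 hb) hN (hN'.mono hsub) hE
  exact hsub

lemma nestedCell_subset_closure_iff (hN : IsReducedNested N) (hN' : IsReducedNested N')
    (hne : (nestedCell M N).Nonempty) (hE : M.E = univ) :
    nestedCell M N ⊆ closure (nestedCell M N') ↔ N ⊆ N' := by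
  refine ⟨fun h ↦ ?_, fun h ↦ nestedCell_subset_closure hN' h hE⟩
  obtain ⟨ω, hω⟩ := hne
  obtain ⟨-, a, ha⟩ := mem_nestedCell.1 hω
  exact ha.subset_of_mem_closure hN hN' hE (h hω)

end Closure

section Realization

variable {ι : Type*} [Fintype ι] {K : PreAbstractSimplicialComplex ι} {X : Finset ι} {t : ι → ℝ}

lemma mem_realization : t ∈ realization K ↔ ∃ X ∈ K.faces, t ∈ openSimplex X := by
  simp only [realization, mem_iUnion, exists_prop]

lemma nonneg_of_mem_openSimplex (ht : t ∈ openSimplex X) (i : ι) : 0 ≤ t i := by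
  by_cases hi : i ∈ X
  exacts [(ht.1 i hi).le, (ht.2.1 i hi).ge]

lemma mem_realization_iff_stdSimplex :
    t ∈ realization K ↔ ∃ X ∈ K.faces, t ∈ stdSimplex ℝ ι ∧ ∀ i ∉ X, t i = 0 := by
  classical
  rw [mem_realization]
  constructor
  · rintro ⟨X, hX, ht⟩
    exact ⟨X, hX, ⟨nonneg_of_mem_openSimplex ht, ht.2.2⟩, ht.2.1⟩
  · rintro ⟨X, hX, ⟨hnonneg, hsum⟩, hzero⟩
    have hzero' : ∀ i ∉ X.filter (0 < t ·), t i = 0 := fun i hi ↦ by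
      by_cases hiX : i ∈ X
      · exact (hnonneg i).antisymm' (not_lt.1 fun hp ↦ hi (Finset.mem_filter.2 ⟨hiX, hp⟩))
      · exact hzero i hiX
    have hne : (X.filter (0 < t ·)).Nonempty := by
      by_contra! hne
      rw [Finset.sum_eq_zero fun i _ ↦ hzero' i (hne ▸ Finset.notMem_empty i)] at hsum
      exact zero_ne_one hsum
    exact ⟨X.filter (0 < t ·), (K.isRelLowerSet_faces hX).2 (Finset.filter_subset _ _) hne,
      fun i hi ↦ (Finset.mem_filter.1 hi).2, hzero', hsum⟩

lemma isCompact_realization (K : PreAbstractSimplicialComplex ι) : IsCompact (realization K) := by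
  have heq : realization K = ⋃ X ∈ K.faces, stdSimplex ℝ ι ∩ {t | ∀ i ∉ X, t i = 0} := by
    ext t
    simp only [mem_realization_iff_stdSimplex, mem_iUnion, exists_prop, mem_inter_iff,
      mem_ofPred_eq]
  rw [heq]
  refine (toFinite K.faces).isCompact_biUnion fun X _ ↦ (isCompact_stdSimplex ℝ ι).inter_right ?_
  simp only [ofPred_forall]
  exact isClosed_biInter fun i _ ↦ isClosed_eq (continuous_apply i) continuous_const

lemma isRealizationOf_of_bijOn {β : Type*} [TopologicalSpace β] [T2Space β] {Z : Set β}
    {cell : Finset ι → Set β} {f : (ι → ℝ) → β} (hcont : ContinuousOn f (realization K))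
    (hf : BijOn f (realization K) Z) (hcell : ∀ X ∈ K.faces, f '' openSimplex X = cell X) :
    IsRealizationOf K Z cell := by
  have : CompactSpace (realization K) := isCompact_iff_compactSpace.1 (isCompact_realization K)
  have he : Continuous (hf.equiv f) := hcont.mapsToRestrict hf.mapsTo
  refine ⟨he.homeoOfEquivCompactToT2, fun X hX ↦ ?_⟩
  rw [← hcell X hX]
  ext z
  constructor
  · rintro ⟨t, ht, rfl⟩
    exact ⟨t, ht, rfl⟩
  · rintro ⟨t, ht, rfl⟩
    exact ⟨⟨t, mem_realization.2 ⟨X, hX, ht⟩⟩, ht, rfl⟩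

end Realization

section NestedRealization

variable {α : Type*} [Fintype α] {M : Matroid α} {N N' : Finset (Flats M)}
  {a t t' : Flats M → ℝ} {ω : α → ℝ}

/-- The linear map sending the vertex `G` of the nested set complex to the projection of `-1_G` to
the weight vectors with sum zero on every connected component. -/
def simplexMap (M : Matroid α) : (Flats M → ℝ) →ₗ[ℝ] (α → ℝ) :=
  -(componentProj M ∘ₗ flatComb)

lemma simplexMap_apply (t : Flats M → ℝ) : simplexMap M t = componentProj M (-flatComb t) :=
  (map_neg (componentProj M) _).symm

lemma isConeVector_simplexMap (hN : IsReducedNested N) (ht : t ∈ openSimplex N) :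
    IsConeVector N (t + componentMean M (-flatComb t)) (simplexMap M t) :=
  simplexMap_apply t ▸ IsConeVector.componentProj ⟨ht.1, fun G hG _ ↦ ht.2.1 G hG, rfl⟩ hN

lemma sum_pos_of_pos_of_eq_zero {ι : Type*} [Fintype ι] {X : Finset ι} {t : ι → ℝ}
    (hX : X.Nonempty) (hpos : ∀ i ∈ X, 0 < t i) (hzero : ∀ i ∉ X, t i = 0) : 0 < ∑ i, t i := by
  rw [← Finset.sum_subset X.subset_univ fun i _ hi ↦ hzero i hi]
  exact Finset.sum_pos hpos hX

lemma inv_sum_smul_mem_openSimplex {ι : Type*} [Fintype ι] {X : Finset ι} {t : ι → ℝ}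
    (hsum : 0 < ∑ i, t i) (hpos : ∀ i ∈ X, 0 < t i) (hzero : ∀ i ∉ X, t i = 0) :
    (∑ i, t i)⁻¹ • t ∈ openSimplex X := by
  refine ⟨fun i hi ↦ mul_pos (inv_pos.2 hsum) (hpos i hi), fun i hi ↦ ?_, ?_⟩
  · rw [Pi.smul_apply, hzero i hi, smul_zero]
  · simp only [Pi.smul_apply, ← Finset.smul_sum]
    exact inv_mul_cancel₀ hsum.ne'

variable [M.Loopless]

lemma simplexMap_mem_componentSumZero (t : Flats M → ℝ) :
    simplexMap M t ∈ componentSumZero M :=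
  simplexMap_apply t ▸ componentProj_mem_componentSumZero _

lemma simplexMap_ne_zero (hN : IsReducedNested N) (hne : N.Nonempty) (ht : t ∈ openSimplex N)
    (hE : M.E = univ) : simplexMap M t ≠ 0 := by
  intro h0
  have ht0 := isConeVector_simplexMap hN ht
  rw [h0] at ht0
  have hempty : IsConeVector (∅ : Finset (Flats M)) 0 (0 : α → ℝ) :=
    ⟨by simp, fun _ _ _ ↦ rfl, by rw [map_zero, neg_zero]⟩
  exact hne.ne_empty (ht0.unique hempty hN (hN.mono (Finset.empty_subset N)) hE).1

lemma normalizeWeight_simplexMap_mem (hN : IsReducedNested N) (hne : N.Nonempty)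
    (ht : t ∈ openSimplex N) (hE : M.E = univ) :
    normalizeWeight (simplexMap M t) ∈ nestedCell M N ∩ componentSumZero M :=
  ⟨(isConeVector_simplexMap hN ht).normalizeWeight_mem_nestedCell
    (simplexMap_ne_zero hN hne ht hE)
    (sum_eq_zero_of_mem_componentSumZero (simplexMap_mem_componentSumZero t) hE),
    smul_mem_componentSumZero (simplexMap_mem_componentSumZero t) _⟩

lemma eq_of_normalizeWeight_simplexMap_eq (hN : IsReducedNested N) (hN' : IsReducedNested N')
    (hne : N.Nonempty) (hne' : N'.Nonempty) (ht : t ∈ openSimplex N) (ht' : t' ∈ openSimplex N')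
    (hE : M.E = univ)
    (heq : normalizeWeight (simplexMap M t) = normalizeWeight (simplexMap M t')) : t = t' := by
  set c := (√(∑ e, simplexMap M t e ^ 2))⁻¹
  set c' := (√(∑ e, simplexMap M t' e ^ 2))⁻¹
  have hc : 0 < c := inv_sqrt_sum_sq_pos (simplexMap_ne_zero hN hne ht hE)
  have hc' : 0 < c' := inv_sqrt_sum_sq_pos (simplexMap_ne_zero hN' hne' ht' hE)
  have hcone : IsConeVector N _ (normalizeWeight (simplexMap M t)) :=
    (isConeVector_simplexMap hN ht).smul hc
  obtain ⟨rfl, hab⟩ := (heq ▸ hcone).unique ((isConeVector_simplexMap hN' ht').smul hc') hN hN' hE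
  have hscale (G : Flats M) : c * t G = c' * t' G := by
    by_cases hG : G ∈ N
    · simpa only [Pi.smul_apply, Pi.add_apply, componentMean_of_not_maximal (hN.2 G hG), add_zero,
        smul_eq_mul] using congrFun hab G
    · rw [ht.2.1 G hG, ht'.2.1 G hG, mul_zero, mul_zero]
  have hcc : c = c' := by
    have hsum := Finset.sum_congr rfl fun G (_ : G ∈ Finset.univ) ↦ hscale G
    rwa [← Finset.mul_sum, ← Finset.mul_sum, ht.2.2, ht'.2.2, mul_one, mul_one] at hsum
  exact funext fun G ↦ mul_left_cancel₀ hc.ne' ((hscale G).trans (by rw [hcc]))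

open Classical in
lemma IsConeVector.simplexMap_ite_mem (ha : IsConeVector N a ω) (hω : ω ∈ componentSumZero M) :
    simplexMap M (fun G ↦ if G ∈ N then a G else 0) = ω := by
  have hd : ∀ G, ¬ Maximal IsIrred G → (a - fun G ↦ if G ∈ N then a G else 0) G = 0 := by
    intro G hG
    by_cases hGN : G ∈ N
    · simp only [Pi.sub_apply, hGN, if_true, sub_self]
    · simp only [Pi.sub_apply, hGN, if_false, ha.eq_zero G hGN hG, sub_self]
  have hzero : simplexMap M (a - fun G ↦ if G ∈ N then a G else 0) = 0 := by
    rw [simplexMap_apply, map_neg, componentProj_flatComb hd, neg_zero]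
  rw [map_sub, sub_eq_zero] at hzero
  rw [← hzero, simplexMap_apply, ← ha.eq, componentProj_eq_self hω]

lemma exists_normalizeWeight_simplexMap_eq (hω : ω ∈ nestedCell M N ∩ componentSumZero M) :
    N.Nonempty ∧ ∃ t ∈ openSimplex N, normalizeWeight (simplexMap M t) = ω := by
  classical
  obtain ⟨hωs, a, ha⟩ := mem_nestedCell.1 hω.1
  have hmap := ha.simplexMap_ite_mem hω.2
  set s : Flats M → ℝ := fun G ↦ if G ∈ N then a G else 0
  have hzero : ∀ G ∉ N, s G = 0 := fun G hG ↦ if_neg hG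
  have hpos : ∀ G ∈ N, 0 < s G := fun G hG ↦ (ha.pos G hG).trans_eq (if_pos hG).symm
  have hne : N.Nonempty := by
    by_contra! hne
    have hs0 : s = 0 := funext fun G ↦ hzero G (hne ▸ Finset.notMem_empty G)
    rw [hs0, map_zero] at hmap
    exact ne_zero_of_mem_weightSphere hωs hmap.symm
  have hsum := sum_pos_of_pos_of_eq_zero hne hpos hzero
  refine ⟨hne, _, inv_sum_smul_mem_openSimplex hsum hpos hzero, ?_⟩
  rw [map_smul, normalizeWeight_smul (inv_pos.2 hsum), hmap, normalizeWeight_eq_self hωs]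

lemma image_normalizeWeight_simplexMap (hN : IsReducedNested N) (hne : N.Nonempty)
    (hE : M.E = univ) :
    (fun t ↦ normalizeWeight (simplexMap M t)) '' openSimplex N =
      nestedCell M N ∩ componentSumZero M := by
  refine Subset.antisymm (image_subset_iff.2 fun t ht ↦ ?_) fun ω hω ↦ ?_
  · exact normalizeWeight_simplexMap_mem hN hne ht hE
  · obtain ⟨-, t, ht, rfl⟩ := exists_normalizeWeight_simplexMap_eq hω
    exact ⟨t, ht, rfl⟩

lemma continuousOn_normalizeWeight_simplexMap (hE : M.E = univ) :
    ContinuousOn (fun t ↦ normalizeWeight (simplexMap M t))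
      (realization (nestedSetComplex (Flats M))) := by
  intro t ht
  obtain ⟨N, hN, ht⟩ := mem_realization.1 ht
  exact ((continuousAt_normalizeWeight (simplexMap_ne_zero hN.2 hN.1 ht hE)).comp
    (LinearMap.continuous_of_finiteDimensional (simplexMap M)).continuousAt).continuousWithinAt

lemma bijOn_normalizeWeight_simplexMap (hE : M.E = univ) :
    BijOn (fun t ↦ normalizeWeight (simplexMap M t)) (realization (nestedSetComplex (Flats M)))
      (bergmanComplex M ∩ componentSumZero M) := by
  refine ⟨fun t ht ↦ ?_, fun t ht t' ht' heq ↦ ?_, fun ω ⟨hω, hω0⟩ ↦ ?_⟩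
  · obtain ⟨N, hN, ht⟩ := mem_realization.1 ht
    exact inter_subset_inter_left _ (nestedCell_subset_bergmanComplex hN.2.1)
      (normalizeWeight_simplexMap_mem hN.2 hN.1 ht hE)
  · obtain ⟨N, hN, ht⟩ := mem_realization.1 ht
    obtain ⟨N', hN', ht'⟩ := mem_realization.1 ht'
    exact eq_of_normalizeWeight_simplexMap_eq hN.2 hN'.2 hN.1 hN'.1 ht ht' hE heq
  · obtain ⟨N, a, hN, ha⟩ := exists_isConeVector_of_loopless hE hω.2
    obtain ⟨hne, t, ht, rfl⟩ :=
      exists_normalizeWeight_simplexMap_eq ⟨mem_nestedCell.2 ⟨hω.1, a, ha⟩, hω0⟩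
    exact ⟨t, mem_realization.2 ⟨N, ⟨hne, hN⟩, ht⟩, rfl⟩

lemma isRealizationOf_nestedSetComplex (hE : M.E = univ) :
    IsRealizationOf (nestedSetComplex (Flats M)) (bergmanComplex M ∩ componentSumZero M)
      (fun N ↦ nestedCell M N ∩ componentSumZero M) :=
  isRealizationOf_of_bijOn (continuousOn_normalizeWeight_simplexMap hE)
    (bijOn_normalizeWeight_simplexMap hE)
    fun _ hN ↦ image_normalizeWeight_simplexMap hN.2 hN.1 hE

lemma isRealizationOf_nestedSetComplex_of_isConnectedSet (hE : M.E = univ)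
    (hM : IsConnectedSet M univ) :
    IsRealizationOf (nestedSetComplex (Flats M)) (bergmanComplex M) (nestedCell M) := by
  have hsub := weightSphere_subset_componentSumZero hE hM
  have hcell (N) : nestedCell M N ∩ componentSumZero M = nestedCell M N :=
    inter_eq_left.2 fun _ hω ↦ hsub hω.1
  have hbergman : bergmanComplex M ∩ componentSumZero M = bergmanComplex M :=
    inter_eq_left.2 fun _ hω ↦ hsub hω.1
  simpa only [hcell, hbergman] using isRealizationOf_nestedSetComplex hE

end NestedRealization

section AlternatingWord

open CoxeterSystem

variable {B W : Type*} [Group W] {M : CoxeterMatrix B} (cs : CoxeterSystem M W) {w u : W} {s t : B}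
  {k : ℕ}

lemma not_isRightDescent_of_eq_mul_alternatingWord (hs : ¬ cs.IsRightDescent w s)
    (hw : w = u * cs.wordProd (alternatingWord s t k)) (hl : cs.length u + k = cs.length w) :
    ¬ cs.IsRightDescent u (if Even k then s else t) := by
  cases k with
  | zero => simpa [hw, alternatingWord] using hs
  | succ j =>
    intro hd
    have hlt := cs.isRightDescent_iff.1 hd
    have hle := cs.length_mul_le (u * cs.simple (if Even (j + 1) then s else t))
      (cs.wordProd (alternatingWord s t j))
    have hj := cs.length_wordProd_le (alternatingWord s t j)
    have hletter : (if Even (j + 1) then s else t) = if Even j then t else s := by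
      simp only [Nat.even_add_one, ite_not]
    rw [length_alternatingWord] at hj
    rw [hletter, mul_assoc, ← cs.wordProd_cons, ← alternatingWord_succ', ← hw] at hle
    rw [hletter] at hlt
    omega

lemma exists_eq_mul_alternatingWord (hs : ¬ cs.IsRightDescent w s)
    (hw : w = u * cs.wordProd (alternatingWord s t k)) (hl : cs.length u + k = cs.length w) :
    ∃ v j, k ≤ j ∧ w = v * cs.wordProd (alternatingWord s t j) ∧
      cs.length v + j = cs.length w ∧ ¬ cs.IsRightDescent v s ∧ ¬ cs.IsRightDescent v t := by
  induction hn : cs.length u generalizing u k with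
  | zero =>
    obtain rfl := cs.length_eq_zero_iff.1 hn
    exact ⟨1, k, le_rfl, hw, hl, cs.not_isRightDescent_one s, cs.not_isRightDescent_one t⟩
  | succ n ih =>
    have hprev := not_isRightDescent_of_eq_mul_alternatingWord cs hs hw hl
    by_cases hnext : cs.IsRightDescent u (if Even k then t else s)
    · have hlen := cs.isRightDescent_iff.1 hnext
      obtain ⟨v, j, hj, hv⟩ := ih (u := u * cs.simple (if Even k then t else s)) (k := k + 1)
        (by rw [alternatingWord_succ', cs.wordProd_cons, mul_assoc,
          cs.simple_mul_simple_cancel_left, hw]) (by omega) (by omega)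
      exact ⟨v, j, by omega, hv⟩
    · refine ⟨u, k, le_rfl, hw, hl, ?_⟩
      split_ifs at hprev hnext
      exacts [⟨hprev, hnext⟩, ⟨hnext, hprev⟩]

lemma eq_zero_or_lt_of_eq_mul_alternatingWord (hs : ¬ cs.IsRightDescent w s)
    (hw : w = u * cs.wordProd (alternatingWord s t k)) (hl : cs.length u + k = cs.length w) :
    M s t = 0 ∨ k < M s t := by
  by_contra! hcon
  have hnot := cs.not_isReduced_alternatingWord t s (m := k + 1)
    (by rw [M.symmetric t s]; exact hcon.1) (by rw [M.symmetric t s]; omega)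
  rw [CoxeterSystem.IsReduced, length_alternatingWord] at hnot
  have hle := cs.length_wordProd_le (alternatingWord t s (k + 1))
  rw [length_alternatingWord] at hle
  have hws : w * cs.simple s = u * cs.wordProd (alternatingWord t s (k + 1)) := by
    rw [alternatingWord_succ, cs.wordProd_concat, ← mul_assoc, hw]
  have hmul := cs.length_mul_le u (cs.wordProd (alternatingWord t s (k + 1)))
  rw [← hws, cs.not_isRightDescent_iff.1 hs] at hmul
  omega

end AlternatingWord

section RootSystem

lemma simpleRoot_nonneg {B : Type*} [DecidableEq B] (s : B) : 0 ≤ simpleRoot s :=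
  Pi.single_nonneg.2 zero_le_one

variable {B W : Type*} [Group W] [Fintype B] [DecidableEq B] {M : CoxeterMatrix B}

lemma simpleReflection_simpleRoot (s t : B) : simpleReflection M s (simpleRoot t) =
    simpleRoot t + (2 * Real.cos (Real.pi / M t s)) • simpleRoot s := by
  rw [simpleReflection_apply, coxeterForm_simpleRoot]
  module

lemma simpleReflection_self (s : B) : simpleReflection M s (simpleRoot s) = -simpleRoot s := by
  rw [simpleReflection_simpleRoot, M.diagonal, Nat.cast_one, div_one, Real.cos_pi]
  module

lemma coxeterForm_comm (x y : B → ℝ) : coxeterForm M x y = coxeterForm M y x := by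
  have h : (coxeterForm M).IsSymm := by
    rw [coxeterForm, Matrix.isSymm_toBilin'_iff_isSymm]
    ext s t
    simp [M.symmetric t s]
  exact h.eq x y

lemma coxeterForm_simpleRoot_self (s : B) : coxeterForm M (simpleRoot s) (simpleRoot s) = 1 := by
  simp [coxeterForm_simpleRoot]

variable (cs : CoxeterSystem M W)

lemma geometricRep_simple (s : B) : geometricRep cs (cs.simple s) = simpleReflection M s :=
  cs.lift_apply_simple (isLiftable_simpleReflection M) s

lemma geometricRep_mul_apply (w w' : W) (x : B → ℝ) :
    geometricRep cs (w * w') x = geometricRep cs w (geometricRep cs w' x) := by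
  rw [map_mul, LinearEquiv.mul_apply]

lemma coxeterForm_geometricRep (w : W) (x y : B → ℝ) :
    coxeterForm M (geometricRep cs w x) (geometricRep cs w y) = coxeterForm M x y := by
  induction w using cs.simple_induction_left with
  | one => simp
  | mul_simple_left w s ih =>
    rw [geometricRep_mul_apply, geometricRep_mul_apply, geometricRep_simple, ← ih]
    simp only [simpleReflection_apply, map_sub, map_smul, LinearMap.sub_apply,
      LinearMap.smul_apply, smul_eq_mul, coxeterForm_simpleRoot_self,
      coxeterForm_comm (simpleRoot s)]
    ring

/-- The coefficients of the roots of the dihedral group of order `2m` in terms of its simple roots: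
`sin (kπ / m) / sin (π / m)`, and `k` for `m = 0`, which encodes `m = ∞`. -/
def dihedralCoeff (m k : ℕ) : ℝ :=
  if m = 0 then k else Real.sin (k * (Real.pi / m)) / Real.sin (Real.pi / m)

lemma dihedralCoeff_add_two (m k : ℕ) : dihedralCoeff m (k + 2) =
    2 * Real.cos (Real.pi / m) * dihedralCoeff m (k + 1) - dihedralCoeff m k := by
  unfold dihedralCoeff
  split_ifs with h
  · simp only [h, Nat.cast_zero, div_zero, Real.cos_zero]
    push_cast
    ring
  · have h1 : ((k + 2 : ℕ) : ℝ) * (Real.pi / m) = (k + 1 : ℕ) * (Real.pi / m) + Real.pi / m := by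
      push_cast; ring
    have h2 : (k : ℝ) * (Real.pi / m) = (k + 1 : ℕ) * (Real.pi / m) - Real.pi / m := by
      push_cast; ring
    rw [h1, h2, Real.sin_add, Real.sin_sub]
    ring

lemma dihedralCoeff_zero (m : ℕ) : dihedralCoeff m 0 = 0 := by
  simp [dihedralCoeff]

lemma sin_pi_div_pos {m : ℕ} (hm : 2 ≤ m) : 0 < Real.sin (Real.pi / m) := by
  have hm1 : (1 : ℝ) < m := by exact_mod_cast hm
  exact Real.sin_pos_of_pos_of_lt_pi (by positivity) (div_lt_self Real.pi_pos hm1)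

lemma dihedralCoeff_one {m : ℕ} (hm : m ≠ 1) : dihedralCoeff m 1 = 1 := by
  unfold dihedralCoeff
  split_ifs with h
  · exact Nat.cast_one
  · rw [Nat.cast_one, one_mul, div_self (sin_pi_div_pos (by omega)).ne']

lemma dihedralCoeff_nonneg {m k : ℕ} (hm : m ≠ 1) (hk : m = 0 ∨ k ≤ m) :
    0 ≤ dihedralCoeff m k := by
  unfold dihedralCoeff
  split_ifs with h
  · positivity
  · have hkm : (k : ℝ) ≤ m := by exact_mod_cast hk.resolve_left h
    have hle : k * (Real.pi / m) ≤ Real.pi := by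
      rw [mul_div_assoc', div_le_iff₀ (by positivity), mul_comm]
      gcongr
    exact div_nonneg (Real.sin_nonneg_of_nonneg_of_le_pi (by positivity) hle)
      (sin_pi_div_pos (by omega)).le

open CoxeterSystem in
lemma geometricRep_alternatingWord {s t : B} (hst : s ≠ t) (k : ℕ) :
    geometricRep cs (cs.wordProd (alternatingWord s t k)) (simpleRoot s) =
      if Even k then dihedralCoeff (M s t) (k + 1) • simpleRoot s +
        dihedralCoeff (M s t) k • simpleRoot t
      else dihedralCoeff (M s t) k • simpleRoot s +
        dihedralCoeff (M s t) (k + 1) • simpleRoot t := by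
  induction k with
  | zero => simp [alternatingWord, dihedralCoeff_zero,
      dihedralCoeff_one (M.off_diagonal s t hst)]
  | succ k ih =>
    rw [alternatingWord_succ', cs.wordProd_cons, geometricRep_mul_apply, ih, geometricRep_simple,
      dihedralCoeff_add_two]
    by_cases hk : Even k
    · simp only [hk, Nat.even_add_one, not_true, if_true, if_false, map_add, map_smul,
        simpleReflection_self, simpleReflection_simpleRoot t s]
      module
    · simp only [hk, Nat.even_add_one, not_false_iff, if_true, if_false, map_add, map_smul,
        simpleReflection_self, simpleReflection_simpleRoot s t, M.symmetric t s]
      module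

variable {w : W} {s : B} {x y : B → ℝ}

lemma geometricRep_simpleRoot_nonneg (h : ¬ cs.IsRightDescent w s) :
    0 ≤ geometricRep cs w (simpleRoot s) := by
  induction hn : cs.length w using Nat.strong_induction_on generalizing w s with
  | _ n ih =>
    rcases eq_or_ne w 1 with rfl | hw
    · simpa using simpleRoot_nonneg s
    obtain ⟨t, ht⟩ := cs.exists_rightDescent_of_ne_one hw
    have hst : s ≠ t := fun hst ↦ h (hst ▸ ht)
    obtain ⟨u, k, hk, hwu, hl, hus, hut⟩ := exists_eq_mul_alternatingWord cs (t := t) (k := 1) h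
      (by simp [CoxeterSystem.alternatingWord]) (cs.isRightDescent_iff.1 ht)
    have hs0 := ih _ (by omega) hus rfl
    have ht0 := ih _ (by omega) hut rfl
    have hkm := eq_zero_or_lt_of_eq_mul_alternatingWord cs h hwu hl
    have hc := dihedralCoeff_nonneg (M.off_diagonal s t hst) (hkm.imp_right le_of_lt)
    have hc' := dihedralCoeff_nonneg (M.off_diagonal s t hst) hkm
    rw [hwu, geometricRep_mul_apply, geometricRep_alternatingWord cs hst]
    split_ifs <;> simp only [map_add, map_smul] <;> positivity

variable {cs}

lemma neg_mem_rootSystem (hx : x ∈ rootSystem cs) : -x ∈ rootSystem cs := by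
  obtain ⟨⟨w, s⟩, rfl⟩ := hx
  exact ⟨(w * cs.simple s, s), by simp [geometricRep_simple, simpleReflection_self]⟩

lemma mem_positiveRoots_or_neg_mem (hx : x ∈ rootSystem cs) :
    x ∈ positiveRoots cs ∨ -x ∈ positiveRoots cs := by
  have hneg := neg_mem_rootSystem hx
  obtain ⟨⟨w, s⟩, rfl⟩ := hx
  by_cases h : cs.IsRightDescent w s
  · have hws := geometricRep_simpleRoot_nonneg cs (cs.isRightDescent_iff_not_isRightDescent_mul.1 h)
    rw [geometricRep_mul_apply, geometricRep_simple, simpleReflection_self, map_neg] at hws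
    exact .inr ⟨hneg, hws⟩
  · exact .inl ⟨⟨(w, s), rfl⟩, geometricRep_simpleRoot_nonneg cs h⟩

lemma simpleRoot_mem_positiveRoots (cs : CoxeterSystem M W) (s : B) :
    simpleRoot s ∈ positiveRoots cs :=
  ⟨⟨(1, s), by simp⟩, simpleRoot_nonneg s⟩

lemma coxeterForm_self (hx : x ∈ rootSystem cs) : coxeterForm M x x = 1 := by
  obtain ⟨⟨w, s⟩, rfl⟩ := hx
  rw [coxeterForm_geometricRep, coxeterForm_simpleRoot_self]

lemma ne_zero_of_mem_rootSystem (hx : x ∈ rootSystem cs) : x ≠ 0 := by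
  rintro rfl
  simpa using coxeterForm_self hx

lemma exists_geometricRep_eq_reflection (hx : x ∈ rootSystem cs) :
    ∃ r : W, ∀ y, geometricRep cs r y = y - (2 * coxeterForm M y x) • x := by
  obtain ⟨⟨w, s⟩, rfl⟩ := hx
  refine ⟨w * cs.simple s * w⁻¹, fun y ↦ ?_⟩
  have hy : geometricRep cs w (geometricRep cs w⁻¹ y) = y := by
    rw [← geometricRep_mul_apply, mul_inv_cancel, map_one, LinearEquiv.coe_one, id]
  rw [geometricRep_mul_apply, geometricRep_mul_apply, geometricRep_simple, simpleReflection_apply,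
    map_sub, map_smul, hy, ← coxeterForm_geometricRep cs w, hy]

lemma geometricRep_mem_rootSystem (w : W) (hx : x ∈ rootSystem cs) :
    geometricRep cs w x ∈ rootSystem cs := by
  obtain ⟨⟨w', s⟩, rfl⟩ := hx
  exact ⟨(w * w', s), geometricRep_mul_apply cs w w' _⟩

lemma reflection_mem_rootSystem (hx : x ∈ rootSystem cs) (hy : y ∈ rootSystem cs) :
    y - (2 * coxeterForm M y x) • x ∈ rootSystem cs := by
  obtain ⟨r, hr⟩ := exists_geometricRep_eq_reflection hx
  exact hr y ▸ geometricRep_mem_rootSystem r hy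

section InvariantForm

variable [Fintype W]

variable (cs) in
/-- The sum over `W` of the translates of the standard inner product, a positive definite
`W`-invariant bilinear form. -/
def invariantForm : LinearMap.BilinForm ℝ (B → ℝ) :=
  ∑ w : W, (dotProductBilin ℝ ℝ).compl₁₂ (geometricRep cs w).toLinearMap
    (geometricRep cs w).toLinearMap

lemma invariantForm_apply (x y : B → ℝ) :
    invariantForm cs x y = ∑ w : W, geometricRep cs w x ⬝ᵥ geometricRep cs w y := by
  simp [invariantForm]

lemma invariantForm_geometricRep (g : W) (x y : B → ℝ) :
    invariantForm cs (geometricRep cs g x) (geometricRep cs g y) = invariantForm cs x y := by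
  simp only [invariantForm_apply, ← geometricRep_mul_apply]
  exact Fintype.sum_equiv (Equiv.mulRight g) _ _ fun _ ↦ rfl

lemma invariantForm_self_pos (hx : x ≠ 0) : 0 < invariantForm cs x x := by
  rw [invariantForm_apply]
  refine Finset.sum_pos (fun w _ ↦ ?_) Finset.univ_nonempty
  exact Matrix.dotProduct_self_star_pos_iff.2 ((geometricRep cs w).map_ne_zero_iff.2 hx)

lemma invariantForm_root (hx : x ∈ rootSystem cs) (y : B → ℝ) :
    invariantForm cs y x = coxeterForm M y x * invariantForm cs x x := by
  obtain ⟨r, hr⟩ := exists_geometricRep_eq_reflection hx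
  have h := invariantForm_geometricRep (cs := cs) r y x
  rw [hr, hr, coxeterForm_self hx] at h
  simp only [map_sub, map_smul, LinearMap.sub_apply, LinearMap.smul_apply, smul_eq_mul] at h
  linarith

end InvariantForm

lemma disjoint_span_of_coxeterForm_eq_zero [Finite W] {X Y : Set (B → ℝ)}
    (hY : Y ⊆ rootSystem cs) (h : ∀ x ∈ X, ∀ y ∈ Y, coxeterForm M x y = 0) :
    Disjoint (Submodule.span ℝ X) (Submodule.span ℝ Y) := by
  have := Fintype.ofFinite W
  have hXY : ∀ x ∈ X, Submodule.span ℝ Y ≤ LinearMap.ker (invariantForm cs x) :=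
    fun x hx ↦ Submodule.span_le.2 fun y hy ↦ by
      rw [SetLike.mem_coe, LinearMap.mem_ker, invariantForm_root (hY hy), h x hx y hy, zero_mul]
  refine Submodule.disjoint_def.2 fun z hzX hzY ↦ ?_
  have hz : Submodule.span ℝ X ≤ LinearMap.ker ((invariantForm cs).flip z) :=
    Submodule.span_le.2 fun x hx ↦ hXY x hx hzY
  by_contra hz0
  exact (invariantForm_self_pos hz0).ne' (hz hzX)

end RootSystem

lemma Skew.notMem_closure_union {α : Type*} {M : Matroid α} {F T T' : Set α} {e : α}
    (h : Skew (M ／ F) T T') (hF : M.IsFlat F) (he : e ∈ T) (heF : e ∉ F) :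
    e ∉ M.closure (T' ∪ F) := fun hcl ↦ by
  have hcl' : e ∈ (M ／ F).closure (∅ ∪ T') := by
    rw [empty_union, M.contract_closure_eq]
    exact ⟨hcl, heF⟩
  have hloop := h.mem_closure_left he (empty_subset T) subset_rfl hcl'
  rw [M.contract_closure_eq, empty_union, hF.closure] at hloop
  exact heF hloop.1

section RootMatroid

open Submodule (span)

variable {B W : Type*} [Group W] [Fintype B] [DecidableEq B] {M : CoxeterMatrix B}
  {cs : CoxeterSystem M W} {F G I T T' X Y : Set (positiveRoots cs)} {e f g : positiveRoots cs}

lemma rootMatroid_indep_iff :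
    (rootMatroid cs).Indep I ↔ LinearIndepOn ℝ (Subtype.val : positiveRoots cs → B → ℝ) I := by
  simp [rootMatroid]

instance : (rootMatroid cs).Loopless :=
  Matroid.loopless_iff_forall_isNonloop.2 fun e _ ↦ Matroid.indep_singleton.1 <|
    rootMatroid_indep_iff.2 (LinearIndepOn.singleton (ne_zero_of_mem_rootSystem e.2.1))

lemma mem_closure_rootMatroid_iff :
    e ∈ (rootMatroid cs).closure X ↔ (e : B → ℝ) ∈ span ℝ (Subtype.val '' X) := by
  have hindep : ∀ {I} {e : positiveRoots cs}, (rootMatroid cs).Indep I →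
      (e ∈ (rootMatroid cs).closure I ↔ (e : B → ℝ) ∈ span ℝ (Subtype.val '' I)) := by
    intro I e hI
    rw [hI.mem_closure_iff', (rootMatroid_indep_iff.1 hI).mem_span_iff, rootMatroid_indep_iff]
    exact and_iff_right (mem_univ e)
  obtain ⟨I, hI⟩ := (rootMatroid cs).exists_isBasis X (subset_univ X)
  have hspan : span ℝ (Subtype.val '' X) = span ℝ (Subtype.val '' I) := by
    refine le_antisymm (Submodule.span_le.2 ?_) (Submodule.span_mono (image_mono hI.subset))
    rintro _ ⟨x, hx, rfl⟩
    exact (hindep hI.indep).1 (hI.subset_closure hx)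
  rw [← hI.closure_eq_closure, hindep hI.indep, hspan]

lemma mem_closure_of_smul_eq {a b c : ℝ} (hc : c ≠ 0)
    (h : c • (g : B → ℝ) = a • (e : B → ℝ) + b • (f : B → ℝ)) (he : e ∈ X) (hf : f ∈ X) :
    g ∈ (rootMatroid cs).closure X := by
  rw [mem_closure_rootMatroid_iff, ← Submodule.smul_mem_iff _ hc, h]
  exact add_mem (Submodule.smul_mem _ _ (Submodule.subset_span (mem_image_of_mem _ he)))
    (Submodule.smul_mem _ _ (Submodule.subset_span (mem_image_of_mem _ hf)))

lemma exists_eq_smul_add_coxeterForm_smul (e f : positiveRoots cs) :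
    ∃ g ∈ (rootMatroid cs).closure {e, f}, ∃ c : ℝ,
      (e : B → ℝ) = c • (g : B → ℝ) + (2 * coxeterForm M e f) • (f : B → ℝ) := by
  rcases mem_positiveRoots_or_neg_mem (reflection_mem_rootSystem f.2.1 e.2.1) with h | h
  · exact ⟨⟨_, h⟩, mem_closure_of_smul_eq (e := e) (f := f) one_ne_zero
      (a := 1) (b := -(2 * coxeterForm M e f)) (by module) (by simp) (by simp), 1, by module⟩
  · exact ⟨⟨_, h⟩, mem_closure_of_smul_eq (e := e) (f := f) one_ne_zero
      (a := -1) (b := 2 * coxeterForm M e f) (by module) (by simp) (by simp), -1, by module⟩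

/-- The reflection of `e` in `f` is up to sign a root `g ∈ G`.  If `e` and `f` were not orthogonal,
then each of `e`, `f`, `g` would depend on the other two, but `g` lies in `F`, in `T` or in `T'`. -/
lemma coxeterForm_eq_zero_of_skew_contract (hF : (rootMatroid cs).IsFlat F)
    (hG : (rootMatroid cs).IsFlat G) (hT : T ∪ T' = G \ F) (h : Skew (rootMatroid cs ／ F) T T')
    (he : e ∈ T) (hf : f ∈ T') : coxeterForm M e f = 0 := by
  by_contra hne
  obtain ⟨g, hg, c, heq⟩ := exists_eq_smul_add_coxeterForm_smul e f
  have heG : e ∈ G \ F := hT ▸ .inl he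
  have hfG : f ∈ G \ F := hT ▸ .inr hf
  have hgG : g ∈ G := closure_subset_of_isFlat hG (pair_subset heG.1 hfG.1) hg
  by_cases hgT : g ∈ T ∪ F
  · refine h.symm.notMem_closure_union hF hf hfG.2 ?_
    exact mem_closure_of_smul_eq (a := 1) (b := -c) (mul_ne_zero two_ne_zero hne)
      (by rw [one_smul, neg_smul, ← sub_eq_add_neg, eq_sub_iff_add_eq', ← heq])
      (.inl he) hgT
  · rw [mem_union, not_or] at hgT
    have hgT' : g ∈ T' := (hT ▸ ⟨hgG, hgT.2⟩ : g ∈ T ∪ T').resolve_left hgT.1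
    refine h.notMem_closure_union hF he heG.2 ?_
    exact mem_closure_of_smul_eq one_ne_zero (by rw [one_smul, ← heq]) (.inl hgT') (.inl hf)

lemma exists_mem_left_eq_smul_add (hF : (rootMatroid cs).IsFlat F)
    (hG : (rootMatroid cs).IsFlat G) (hT : T ∪ T' = G \ F) (h : Skew (rootMatroid cs ／ F) T T')
    (he : e ∈ T) (hf : f ∈ G ∩ F) : ∃ g ∈ T,
    ∃ c : ℝ, (e : B → ℝ) = c • (g : B → ℝ) + (2 * coxeterForm M e f) • (f : B → ℝ) := by
  obtain ⟨g, hg, c, heq⟩ := exists_eq_smul_add_coxeterForm_smul e f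
  have heG : e ∈ G \ F := hT ▸ .inl he
  have hgG : g ∈ G := closure_subset_of_isFlat hG (pair_subset heG.1 hf.1) hg
  have hgT' : g ∉ T' ∪ F := fun hgT' ↦ h.notMem_closure_union hF he heG.2 <|
    mem_closure_of_smul_eq one_ne_zero (by rw [one_smul, ← heq]) hgT' (.inr hf.2)
  rw [mem_union, not_or] at hgT'
  exact ⟨g, (hT ▸ ⟨hgG, hgT'.2⟩ : g ∈ T ∪ T').resolve_right hgT'.1, c, heq⟩

lemma coxeterForm_eq_zero_of_forall_left (hF : (rootMatroid cs).IsFlat F)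
    (hG : (rootMatroid cs).IsFlat G) (hT : T ∪ T' = G \ F) (h : Skew (rootMatroid cs ／ F) T T')
    (he : e ∈ T) (hf : f ∈ G) (hef : coxeterForm M e f ≠ 0) {y : B → ℝ}
    (hy : ∀ g ∈ T, coxeterForm M g y = 0) : coxeterForm M f y = 0 := by
  by_cases hfF : f ∈ F
  · obtain ⟨g, hg, c, heq⟩ := exists_mem_left_eq_smul_add hF hG hT h he ⟨hf, hfF⟩
    have hsum := hy e he
    rw [heq, map_add, map_smul, map_smul, LinearMap.add_apply, LinearMap.smul_apply,
      LinearMap.smul_apply, hy g hg, smul_zero, zero_add, smul_eq_mul] at hsum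
    exact (mul_eq_zero.1 hsum).resolve_left (mul_ne_zero two_ne_zero hef)
  · rcases (hT ▸ ⟨hf, hfF⟩ : f ∈ T ∪ T') with hfT | hfT'
    · exact hy f hfT
    · exact absurd (coxeterForm_eq_zero_of_skew_contract hF hG hT h he hfT') hef

lemma skew_of_coxeterForm_eq_zero [Finite W] (h : ∀ x ∈ X, ∀ y ∈ Y, coxeterForm M x y = 0) :
    Skew (rootMatroid cs) X Y where
  disjoint := disjoint_left.2 fun x hx hy ↦
    one_ne_zero ((coxeterForm_self x.2.1).symm.trans (h x hx x hy))
  indep_union I J hI hJ hI' hJ' := by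
    rw [rootMatroid_indep_iff] at hI' hJ' ⊢
    refine hI'.union hJ' (disjoint_span_of_coxeterForm_eq_zero (cs := cs) ?_ ?_)
    · rintro _ ⟨y, -, rfl⟩
      exact y.2.1
    · rintro _ ⟨x, hx, rfl⟩ _ ⟨y, hy, rfl⟩
      exact h x (hI hx) y (hJ hy)

variable (cs)

theorem hasConnectedContractions_rootMatroid [Finite W] :
    HasConnectedContractions (rootMatroid cs) := by
  refine fun F G hF hG hFG hconn ↦ ⟨nonempty_of_ssubset hFG, fun T T' hT h ↦ ?_⟩
  by_contra! hne
  obtain ⟨⟨e, he⟩, ⟨f, hf⟩⟩ := hne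
  set X := {x ∈ G | ∃ e ∈ T, coxeterForm M e x ≠ 0}
  set Y := {y ∈ G | ∀ e ∈ T, coxeterForm M e y = 0}
  have hXY : X ∪ Y = G := by
    rw [← sep_or, sep_eq_self_iff_mem_true]
    exact fun x _ ↦ or_iff_not_imp_left.2 fun h ↦ by simpa using h
  have hskew : Skew (rootMatroid cs) X Y :=
    skew_of_coxeterForm_eq_zero fun x ⟨hx, e, he, hex⟩ y ⟨_, hy⟩ ↦
      coxeterForm_eq_zero_of_forall_left hF hG hT h he hx hex hy
  rcases hconn.eq_empty_or_eq_empty hXY hskew with hX | hY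
  · have heX : e ∈ X := ⟨(hT ▸ .inl he : e ∈ G \ F).1, e, he,
      coxeterForm_self e.2.1 ▸ one_ne_zero⟩
    exact notMem_empty e (hX ▸ heX)
  · have hfY : f ∈ Y := ⟨(hT ▸ .inr hf : f ∈ G \ F).1, fun x hx ↦
      coxeterForm_eq_zero_of_skew_contract hF hG hT h hx hf⟩
    exact notMem_empty f (hY ▸ hfY)

lemma cos_pi_div_ne_zero {m : ℕ} (h1 : m ≠ 1) (h2 : m ≠ 2) : Real.cos (Real.pi / m) ≠ 0 := by
  rcases m.eq_zero_or_pos with rfl | hpos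
  · simp
  have hm : (2 : ℝ) < m := by exact_mod_cast (by omega : 2 < m)
  have hpi := Real.pi_pos
  exact (Real.cos_pos_of_mem_Ioo ⟨by linarith [div_pos hpi (two_pos.trans hm)],
    div_lt_div_of_pos_left hpi two_pos hm⟩).ne'

/-- The simple roots as elements of the ground set of the matroid of positive roots. -/
def positiveSimpleRoot (s : B) : positiveRoots cs :=
  ⟨simpleRoot s, simpleRoot_mem_positiveRoots cs s⟩

lemma mem_closure_range_positiveSimpleRoot (e : positiveRoots cs) :
    e ∈ (rootMatroid cs).closure (range (positiveSimpleRoot cs)) := by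
  rw [mem_closure_rootMatroid_iff, pi_eq_sum_univ' (e : B → ℝ)]
  refine Submodule.sum_mem _ fun s _ ↦ Submodule.smul_mem _ _
    (Submodule.subset_span (mem_image_of_mem _ (mem_range_self s)))

variable {cs}

lemma positiveSimpleRoot_mem_of_skew (hconn : (coxeterDiagram M).Connected) (hXY : X ∪ Y = univ)
    (h : Skew (rootMatroid cs) X Y) {s : B} (hs : positiveSimpleRoot cs s ∈ X) (t : B) :
    positiveSimpleRoot cs t ∈ X := by
  obtain ⟨p⟩ := hconn.preconnected s t
  induction p with
  | nil => exact hs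
  | @cons s u _ hadj _ ih =>
    refine ih (by_contra fun hu ↦ ?_)
    have hu' : positiveSimpleRoot cs u ∈ Y := (hXY ▸ mem_univ _ : _ ∈ X ∪ Y).resolve_left hu
    have horth : coxeterForm M (simpleRoot s) (simpleRoot u) = 0 :=
      coxeterForm_eq_zero_of_skew_contract (e := positiveSimpleRoot cs s)
        (f := positiveSimpleRoot cs u) (F := ∅) (G := univ)
        (Matroid.isFlat_iff_closure_eq.2 (by simp [Matroid.closure_empty]))
        (rootMatroid cs).ground_isFlat (by rw [hXY, sdiff_empty])
        (by rwa [Matroid.contract_empty]) hs hu'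
    rw [coxeterForm_simpleRoot, neg_eq_zero] at horth
    exact cos_pi_div_ne_zero (M.off_diagonal s u hadj.1) hadj.2 horth

lemma eq_empty_of_skew_of_positiveSimpleRoot_mem (hconn : (coxeterDiagram M).Connected)
    (hXY : X ∪ Y = univ) (h : Skew (rootMatroid cs) X Y) {s : B}
    (hs : positiveSimpleRoot cs s ∈ X) : Y = ∅ := by
  have hX : range (positiveSimpleRoot cs) ⊆ X :=
    range_subset_iff.2 (positiveSimpleRoot_mem_of_skew hconn hXY h hs)
  exact eq_empty_of_forall_notMem fun e ↦
    (h.disjoint_closure hX).notMem_of_mem_left (mem_closure_range_positiveSimpleRoot cs e)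

theorem isConnectedSet_univ_rootMatroid (cs : CoxeterSystem M W)
    (hconn : (coxeterDiagram M).Connected) : IsConnectedSet (rootMatroid cs) univ := by
  obtain ⟨s⟩ := hconn.nonempty
  refine ⟨⟨positiveSimpleRoot cs s, mem_univ _⟩, fun Y Z hYZ h ↦ ?_⟩
  rcases (hYZ ▸ mem_univ (positiveSimpleRoot cs s) : _ ∈ Y ∪ Z) with hs | hs
  · exact .inr (eq_empty_of_skew_of_positiveSimpleRoot_mem hconn hYZ h hs)
  · exact .inl (eq_empty_of_skew_of_positiveSimpleRoot_mem hconn (union_comm Y Z ▸ hYZ) h.symm hs)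

end RootMatroid

end CoxeterBergman

end

theorem theorem2_general {α : Type*} [Fintype α] {M : Matroid α} [M.Loopless] (hE : M.E = univ)
    (hM : HasConnectedContractions M) :
    coarseCells M = {C | C.Nonempty ∧ ∃ N, IsReducedNested N ∧ C = nestedCell M N} ∧
    (∀ N N' : Finset (Flats M), IsReducedNested N → IsReducedNested N' →
      (nestedCell M N).Nonempty → (nestedCell M N ⊆ closure (nestedCell M N') ↔ N ⊆ N')) ∧
    IsRealizationOf (nestedSetComplex (Flats M)) (bergmanComplex M ∩ componentSumZero M)
      (fun N ↦ nestedCell M N ∩ componentSumZero M) ∧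
    (IsConnectedSet M univ →
      IsRealizationOf (nestedSetComplex (Flats M)) (bergmanComplex M) (nestedCell M)) :=
  ⟨coarseCells_eq hE hM, fun _ _ hN hN' hne ↦ nestedCell_subset_closure_iff hN hN' hne hE,
    isRealizationOf_nestedSetComplex hE, isRealizationOf_nestedSetComplex_of_isConnectedSet hE⟩

theorem theorem2 {B W : Type*} [Fintype B] [DecidableEq B] [Group W] [Finite W]
    {M : CoxeterMatrix B} (cs : CoxeterSystem M W) :
    -- the coarse cells are exactly the (nonempty) cells of the nested sets
    coarseCells (rootMatroid cs) =
        {C | C.Nonempty ∧ ∃ N, IsReducedNested N ∧ C = nestedCell (rootMatroid cs) N} ∧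
    -- the incidences of cells are the inclusions of nested sets
    (∀ N N' : Finset (Flats (rootMatroid cs)), IsReducedNested N → IsReducedNested N' →
      (nestedCell (rootMatroid cs) N).Nonempty →
      (nestedCell (rootMatroid cs) N ⊆ closure (nestedCell (rootMatroid cs) N') ↔ N ⊆ N')) ∧
    -- transversally to the lineality space, the cells form a simplicial complex
    IsRealizationOf (nestedSetComplex (Flats (rootMatroid cs)))
      (bergmanComplex (rootMatroid cs) ∩ componentSumZero (rootMatroid cs))
      (fun N ↦ nestedCell (rootMatroid cs) N ∩ componentSumZero (rootMatroid cs)) ∧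
    -- if the Coxeter system is irreducible, the Bergman complex itself is a simplicial complex
    ((coxeterDiagram M).Connected →
      IsRealizationOf (nestedSetComplex (Flats (rootMatroid cs)))
        (bergmanComplex (rootMatroid cs)) (nestedCell (rootMatroid cs))) := by
  have h := theorem2_general rfl (hasConnectedContractions_rootMatroid cs)
  exact ⟨h.1, h.2.1, h.2.2.1, fun hconn ↦ h.2.2.2 (isConnectedSet_univ_rootMatroid cs hconn)⟩
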